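/- **Setting.** Let $M$ be a connected oriented 3-manifold with one torus cusp, with an oriented ideal triangulation $\mathcal T$ with tetrahedra $\Delta_1,\dots,\Delta_N$ and (hence) $N$ edges $e_1,\dots,e_N$. Let $\alpha:\pi_1(M)\to\mathbb Z$ be a homomorphism, and let $\mu,\lambda$ be peripheral curves with $\alpha(\mu)=1$ and $\alpha(\lambda)=0$ (so $\alpha$ is onto). Let $\gamma\in\{\mu,\lambda\}$, and let $z_1,\dots,z_N\in\mathbb C\setminus\{0,1\}$ be shapes solving the gluing equations of $\mathcal T$ and the completeness equation of $\gamma$. Put $z'=1/(1-z)$, $z''=1-1/z$. *Neumann–Zagier data.* Let $\mathbf G,\mathbf G',\mathbf G''$ be the matrices whose $(i,j)$-entry is the number of edges of $\Delta_j$ that are incident to $e_i$ and have shape parameter $z_j,z_j',z_j''$. Let $\mathbf G_\gamma,\mathbf G_\gamma',\mathbf G_\gamma''$ be obtained by replacing one row by the row of signed exponents of $z_j,z'_j,z''_j$ in the completeness equation of $\gamma$. Put $\mathbf A_\gamma=\mathbf G_\gamma-\mathbf G'_\gamma$, $\mathbf B_\gamma=\mathbf G''_\gamma-\mathbf G'_\gamma$,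 and $\nu_i=\eta_i-\sum_j(\mathbf G'_\gamma)_{ij}$ with $\eta_i=2$ for an edge row and $\eta_i=0$ for the row of $\gamma$. The datum is *nondegenerate* if $\mathbf B_\gamma$ and $-\mathbf B_\gamma^{-1}\mathbf A_\gamma+\Delta_{z'}$ are invertible, where $\Delta_{z'}=\mathrm{diag}(z_j')$; then put $\Pi_\gamma=\hbar(-\mathbf B_\gamma^{-1}\mathbf A_\gamma+\Delta_{z'})^{-1}$. A *flattening* is a pair of integer vectors $(f,f'')$ with $\mathbf A_\gamma f+\mathbf B_\gamma f''=\nu$. *Loop invariants.* With Bernoulli numbers $B_p$ ($B_1=\tfrac12$) and $\mathrm{Li}_{-m}(x)=(x\tfrac{d}{dx})^m\tfrac{x}{1-x}$ put, for $k\ge1$, $$\Gamma^{(k)}_i=(-1)^k\sum_{p\ge\alpha_k}\frac{B_p}{p!}\,\mathrm{Li}_{2-p-k}(z_i^{-1})\,\hbar^{p-1}-\begin{cases}\tfrac12(\mathbf B_\gamma^{-1}\nu)_i&k=1\\0&k\ge2\end{cases}$$ with $\alpha_1=\alpha_2=1$ and $\alpha_k=0$ for $k\ge3$; and, for $\ell\ge2$,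 $$\Gamma^{(0)}=\frac{B_\ell}{\ell!}\sum_i\mathrm{Li}_{2-\ell}(z_i^{-1})+\begin{cases}\tfrac18 f^{t}\mathbf B_\gamma^{-1}\mathbf A_\gamma f&\ell=2\\0&\ell\ge3.\end{cases}$$ Let $\mathcal G_\ell$ be the set of isomorphism classes of finite connected graphs (self-loops and multiple edges allowed, all vertices of degree $\ge1$) for which the number of vertices of degree $1$, plus the number of vertices of degree $2$, plus the first Betti number is at most $\ell$. Let $d(v)$ be the degree of a vertex $v$ and $\sigma(G)$ the order of the automorphism group of $G$ (acting on vertices and half-edges). The $\ell$-loop invariant is $$\Phi_{\mathcal T,\ell}=\mathrm{coeff}\Big[\sum_{G\in\mathcal G_\ell}\frac1{\sigma(G)}\sum_{\iota:V(G)\to\{1,\dots,N\}}\ \prod_{v\in V(G)}\Gamma^{(d(v))}_{\iota(v)}\prod_{(v,v')\in E(G)}(\Pi_\gamma)_{\iota(v),\iota(v')},\ \hbar^{\ell-1}\Big]+\Gamma^{(0)}.$$ *Cyclic covers.* Let $\mathcal T^{(n)}$ be the ideal triangulation induced on the $n$-cyclic cover $M^{(n)}$ corresponding to $\alpha^{-1}(n\mathbb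 Z)$, with the shapes lifted from $\mathcal T$. Its Neumann–Zagier datum is taken with respect to a lift of $\mu^n$ if $\gamma=\mu$, and to a lift of $\lambda$ if $\gamma=\lambda$. Choose lifts $\tilde\Delta_j$ and $\tilde e_i$ to the infinite cyclic cover of $\alpha$, whose deck group is generated by $t$. Let $\mathbf G_k,\mathbf G'_k,\mathbf G''_k$ count the edges of $t^k\tilde\Delta_j$ that are incident to $\tilde e_i$ and have parameter $z_j,z_j',z_j''$. Put $\mathbf A(t)=\sum_k(\mathbf G_k-\mathbf G_k')t^k$, $\mathbf B(t)=\sum_k(\mathbf G_k''-\mathbf G_k')t^k$ and $\Pi(t)=\hbar(-\mathbf B(t)^{-1}\mathbf A(t)+\Delta_{z'})^{-1}$. *Flow weights.* A $\mathbb Z/n\mathbb Z$-flow on a connected graph $G$ with oriented edges is a map $\varphi:E(G)\to\mathbb Z/n\mathbb Z$ such that at each vertex the sum over the incoming edges equals the sum over the outgoing edges. With $\omega=e^{2\pi\sqrt{-1}/n}$, let $\Pi_{\varphi(e)}=\Pi_\gamma$ if $\varphi(e)=0$ and $\Pi_{\varphi(e)}=\Pi(\omega^{\varphi(e)})$ otherwise,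 and put $$W^{(n)}_{\mathcal T}(G)=\frac1{\sigma(G)}\sum_{\iota:V(G)\to\{1,\dots,N\}}\frac1{n^{d-1}}\sum_{\varphi}\ \prod_{v\in V(G)}\Gamma^{(d(v))}_{\iota(v)}\prod_{(v,v')\in E(G)}(\Pi_{\varphi(v,v')})_{\iota(v),\iota(v')},$$ where $d$ is the first Betti number of $G$, $\varphi$ runs over all $\mathbb Z/n\mathbb Z$-flows on $G$, and $\Gamma^{(k)}_i$, $\Pi_\gamma$ are those of $\mathcal T$. **Theorem.** Let $n\ge1$ and suppose that the Neumann–Zagier datum of $\mathcal T^{(n)}$ is nondegenerate. Then: 1. The Neumann–Zagier datum of $\mathcal T$ is nondegenerate, and for $0<k<n$ the matrices $\mathbf B(\omega^k)$ and $-\mathbf B(\omega^k)^{-1}\mathbf A(\omega^k)+\Delta_{z'}$ are invertible, so that all the weights $W^{(n)}_{\mathcal T}(G)$ are defined. 2. For every connected graph $G$, $W^{(n)}_{\mathcal T}(G)$ does not depend on the choice of the orientations of the edges of $G$. 3. For every $\ell\ge2$ the set $\mathcal G_\ell$ is finite, and for every flattening of $\mathcal T^{(n)}$ $$\Phi_{\mathcal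 T^{(n)},\ell}=\mathrm{coeff}\Big[\sum_{G\in\mathcal G_\ell}W^{(n)}_{\mathcal T}(G),\ \hbar^{\ell-1}\Big]+\Gamma^{(0)},$$ where $\Gamma^{(0)}$ is the vacuum contribution of $\mathcal T^{(n)}$. -/

import Mathlib

open scoped LaurentPolynomial

/-! ### Oriented ideal triangulations -/

/-- An edge of the tetrahedron with vertex set `Fin 4`, as an unordered pair of vertices. -/
abbrev TetEdge : Type := {s : Finset (Fin 4) // s.card = 2}

/-- The image of an edge of a tetrahedron under a relabelling of the vertices. -/
def TetEdge.image (σ : Equiv.Perm (Fin 4)) (s : TetEdge) : TetEdge :=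
  ⟨s.1.map σ.toEmbedding, by rw [Finset.card_map, s.2]⟩

/-- The type of the shape parameter of an edge of a tetrahedron:
`0` stands for `z` (edges `01`, `23`), `1` for `z' = 1/(1-z)` (edges `02`, `13`),
`2` for `z'' = 1 - 1/z` (edges `03`, `12`). Opposite edges have the same parameter. -/
def shapeType (s : Finset (Fin 4)) : Fin 3 :=
  if s = {0, 1} ∨ s = {2, 3} then 0
  else if s = {0, 2} ∨ s = {1, 3} then 1
  else 2

/-- An oriented ideal triangulation whose tetrahedra are indexed by `I`. Each tetrahedron has
vertices `0, 1, 2, 3` (in this order positively oriented), and its face `f` is the one opposite to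
the vertex `f`. The face `f` of the tetrahedron `j` is glued to a face of `nbr j f`; the gluing
is recorded by the bijection `perm j f` of the vertices which sends the vertices of the face `f` to
their images and `f` to the vertex opposite to the image face. Gluings reverse the orientation of
the faces (`perm j f` is odd), come in mutually inverse pairs, and no face is glued to itself. -/
structure IdealTriangulation (I : Type*) where
  nbr : I → Fin 4 → I
  perm : I → Fin 4 → Equiv.Perm (Fin 4)
  nbr_nbr : ∀ j f, nbr (nbr j f) (perm j f f) = j
  perm_perm : ∀ j f, perm (nbr j f) (perm j f f) = (perm j f)⁻¹
  ne_self : ∀ j f, (nbr j f, perm j f f) ≠ (j, f)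
  sign_perm : ∀ j f, Equiv.Perm.sign (perm j f) = -1

namespace IdealTriangulation

variable {I : Type*} (T : IdealTriangulation I)

/-- The elementary identifications of edges of tetrahedra: an edge `s` that lies in the face `f`
is identified with its image under the gluing of that face. -/
def EdgeRel (x y : I × TetEdge) : Prop :=
  ∃ f : Fin 4, f ∉ x.2.1 ∧ y = (T.nbr x.1 f, x.2.image (T.perm x.1 f))

/-- The edges of the triangulation: classes of edges of tetrahedra under the equivalence relation
generated by the face gluings. -/
def Edge : Type _ := Quot T.EdgeRel

open Classical in
/-- The number of edges of the tetrahedron `j` that are incident to the edge `e` of the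
triangulation and have a shape parameter of type `q`. -/
noncomputable def incidence (e : T.Edge) (j : I) (q : Fin 3) : ℕ :=
  (Finset.univ.filter fun s : TetEdge =>
    Quot.mk T.EdgeRel (j, s) = e ∧ shapeType s.1 = q).card

/-- Adjacency of the triangles of the vertex links; the triangle `(j, v)` is the link of the ideal
vertex `v` of the tetrahedron `j`. -/
def LinkAdj (x y : I × Fin 4) : Prop :=
  ∃ f : Fin 4, f ≠ x.2 ∧ y = (T.nbr x.1 f, T.perm x.1 f x.2)

/-- The underlying oriented manifold is connected with exactly one end, and the link of that end
is a torus. The link is a closed oriented surface with `4N` triangles, `6N` edges and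
two vertices for each edge of the triangulation, so that, once it is connected, it is a torus if
and only if the triangulation has as many edges as tetrahedra. -/
def IsOneCusped : Prop :=
  Nonempty I ∧ (∀ x y : I × Fin 4, Relation.EqvGen T.LinkAdj x y) ∧
    Finite T.Edge ∧ Nat.card T.Edge = Nat.card I

/-- Rotation about an edge. A flag `(j, p)` stands for the edge `{p 0, p 1}` of the tetrahedron `j`;
one leaves `j` through the face `p 3`, and in the next tetrahedron the face entered is recorded
in position `2` and the other face containing the edge in position `3`. -/
def rot (x : I × Equiv.Perm (Fin 4)) : I × Equiv.Perm (Fin 4) :=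
  (T.nbr x.1 (x.2 3), T.perm x.1 (x.2 3) * x.2 * Equiv.swap 2 3)

/-- A homomorphism `α : π₁(M) → ℤ` together with a choice of lifts of the tetrahedra to the
corresponding infinite cyclic cover, i.e. an integral 1-cocycle on the dual 2-complex of the
triangulation: crossing the face `f` of the tetrahedron `j` counts `val j f`, crossing backwards
counts the opposite, and the total along any loop around an edge is zero. -/
structure DualCocycle where
  val : I → Fin 4 → ℤ
  antisymm : ∀ j f, val (T.nbr j f) (T.perm j f f) = - val j f
  closed : ∀ (x : I × Equiv.Perm (Fin 4)) (m : ℕ), T.rot^[m] x = x →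
    ∑ i ∈ Finset.range m, val (T.rot^[i] x).1 ((T.rot^[i] x).2 3) = 0

/-- An oriented closed normal curve in the link of the ideal vertices, given as an infinite sequence
of arcs which is periodic with period `len`. The `i`-th arc lies in the triangle
`(tet i, arc i 0)`, enters through the face `arc i 2`, leaves through the face `arc i 3`, and so
cuts off the corner of the triangle at the edge `{arc i 0, arc i 1}` of the tetrahedron. -/
structure PeripheralCurve where
  len : ℕ
  len_pos : 0 < len
  tet : ℕ → I
  arc : ℕ → Equiv.Perm (Fin 4)
  tet_periodic : ∀ i, tet (i + len) = tet i
  arc_periodic : ∀ i, arc (i + len) = arc i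
  tet_succ : ∀ i, tet (i + 1) = T.nbr (tet i) (arc i 3)
  vertex_succ : ∀ i, arc (i + 1) 0 = T.perm (tet i) (arc i 3) (arc i 0)
  face_succ : ∀ i, arc (i + 1) 2 = T.perm (tet i) (arc i 3) (arc i 3)

namespace DualCocycle

variable {T} {H : Type*} [AddCommGroup H]

/-- The regular cover with deck group `H` attached to the composite of `α` with `φ : ℤ → H`.
Its tetrahedra are the translates `(j, h)`, for `h` in `H`, of the chosen lifts of the tetrahedra
`j`. (It is connected if and only if `φ ∘ α` is onto.) -/
def cover (c : T.DualCocycle) (φ : ℤ →+ H) : IdealTriangulation (I × H) where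
  nbr x f := (T.nbr x.1 f, x.2 + φ (c.val x.1 f))
  perm x f := T.perm x.1 f
  nbr_nbr := by
    rintro ⟨j, h⟩ f
    simp [T.nbr_nbr, c.antisymm]
  perm_perm := by
    rintro ⟨j, h⟩ f
    exact T.perm_perm j f
  ne_self := by
    rintro ⟨j, h⟩ f hx
    simp only [Prod.mk.injEq] at hx
    exact T.ne_self j f (by rw [hx.1.1, hx.2])
  sign_perm := by
    rintro ⟨j, h⟩ f
    exact T.sign_perm j f

/-- The infinite cyclic cover. -/
abbrev infiniteCover (c : T.DualCocycle) : IdealTriangulation (I × ℤ) :=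
  c.cover (AddMonoidHom.id ℤ)

/-- The `n`-cyclic cover. -/
abbrev cyclicCover (c : T.DualCocycle) (n : ℕ) : IdealTriangulation (I × ZMod n) :=
  c.cover (Int.castAddHom (ZMod n))

/-- The projection from the edges of a cover to the edges of the triangulation. -/
def coverProj (c : T.DualCocycle) (φ : ℤ →+ H) : (c.cover φ).Edge → T.Edge :=
  Quot.map (fun x => (x.1.1, x.2)) (by
    rintro ⟨⟨j, h⟩, s⟩ y ⟨f, hf, rfl⟩
    exact ⟨f, hf, rfl⟩)

/-- The value of `α` on (an initial segment of) a peripheral curve. -/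
def partialEval (c : T.DualCocycle) (γ : T.PeripheralCurve) (m : ℕ) : ℤ :=
  ∑ i ∈ Finset.range m, c.val (γ.tet i) (γ.arc i 3)

/-- The value `α(γ)`. -/
def eval (c : T.DualCocycle) (γ : T.PeripheralCurve) : ℤ := c.partialEval γ γ.len

theorem partialEval_add_len (c : T.DualCocycle) (γ : T.PeripheralCurve) (m : ℕ) :
    c.partialEval γ (m + γ.len) = c.partialEval γ m + c.eval γ := by
  induction m with
  | zero => simp [eval, partialEval]
  | succ m ih =>
    have h1 : c.partialEval γ (m + 1 + γ.len)
        = c.partialEval γ (m + γ.len) + c.val (γ.tet m) (γ.arc m 3) := by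
      rw [show m + 1 + γ.len = m + γ.len + 1 by omega]
      simp only [partialEval, Finset.sum_range_succ, γ.tet_periodic, γ.arc_periodic]
    have h2 : c.partialEval γ (m + 1) = c.partialEval γ m + c.val (γ.tet m) (γ.arc m 3) := by
      simp only [partialEval, Finset.sum_range_succ]
    rw [h1, h2, ih]
    ring

theorem partialEval_add_mul (c : T.DualCocycle) (γ : T.PeripheralCurve) (m r : ℕ) :
    c.partialEval γ (m + r * γ.len) = c.partialEval γ m + r * c.eval γ := by
  induction r with
  | zero => simp
  | succ r ih =>
    rw [show m + (r + 1) * γ.len = m + r * γ.len + γ.len by ring, partialEval_add_len, ih]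
    push_cast
    ring

/-- The closed lift to the `n`-cyclic cover, starting at the tetrahedron with second coordinate
`a`, of the smallest power of `γ` that lifts to a closed curve. This is a lift of the power `γ ^ r`,
with `r` the order of `α(γ)` in `ℤ / n`: of `γ ^ n` if `α(γ) = 1`, and of `γ` if `α(γ) = 0`. -/
noncomputable def liftCurve (c : T.DualCocycle) (n : ℕ) [NeZero n] (γ : T.PeripheralCurve)
    (a : ZMod n) : (c.cyclicCover n).PeripheralCurve where
  len := addOrderOf (c.eval γ : ZMod n) * γ.len
  len_pos := Nat.mul_pos (addOrderOf_pos _) γ.len_pos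
  tet i := (γ.tet i, a + (c.partialEval γ i : ZMod n))
  arc i := γ.arc i
  tet_periodic i := by
    have h : ∀ r : ℕ, γ.tet (i + r * γ.len) = γ.tet i := by
      intro r
      induction r with
      | zero => simp
      | succ r ih =>
        rw [show i + (r + 1) * γ.len = i + r * γ.len + γ.len by ring, γ.tet_periodic, ih]
    have h0 : (addOrderOf (c.eval γ : ZMod n) : ZMod n) * (c.eval γ : ZMod n) = 0 := by
      rw [← nsmul_eq_mul, addOrderOf_nsmul_eq_zero]
    rw [h, partialEval_add_mul]
    push_cast
    rw [h0, add_zero]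
  arc_periodic i := by
    have h : ∀ r : ℕ, γ.arc (i + r * γ.len) = γ.arc i := by
      intro r
      induction r with
      | zero => simp
      | succ r ih =>
        rw [show i + (r + 1) * γ.len = i + r * γ.len + γ.len by ring, γ.arc_periodic, ih]
    exact h _
  tet_succ i := by
    simp only [cover, γ.tet_succ, partialEval, Finset.sum_range_succ, Int.coe_castAddHom]
    push_cast
    rw [add_assoc]
  vertex_succ i := γ.vertex_succ i
  face_succ i := γ.face_succ i

end DualCocycle

end IdealTriangulation

/-! ### Gluing equations and Neumann-Zagier data -/

/-- A Neumann-Zagier datum: the integer matrices `A`, `B`, the integer vector `ν` and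
the shapes `z`; the gluing equations read `A log z + B log z'' = π i ν` in logarithmic form. -/
structure NZDatum (J : Type*) where
  A : Matrix J J ℤ
  B : Matrix J J ℤ
  ν : J → ℤ
  z : J → ℂ

namespace IdealTriangulation

variable {I : Type*} [DecidableEq I] (T : IdealTriangulation I)

/-- The row `q` of exponents of the completeness equation of a peripheral curve: the signed number
of arcs of the curve in the tetrahedron `j` that go around an edge of type `q`. -/
def curveRow (γ : T.PeripheralCurve) (q : Fin 3) (j : I) : ℤ :=
  ∑ i ∈ Finset.range γ.len,
    if γ.tet i = j ∧ shapeType {γ.arc i 0, γ.arc i 1} = q then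
      ((Equiv.Perm.sign (γ.arc i) : ℤˣ) : ℤ) else 0

/-- The matrix `G` (`q = 0`), `G'` (`q = 1`) or `G''` (`q = 2`) with respect to
the numbering `e` of the edges. -/
noncomputable def gluingMatrix (e : I ≃ T.Edge) (q : Fin 3) : Matrix I I ℤ :=
  Matrix.of fun i j => (T.incidence (e i) j q : ℤ)

/-- The matrix `G_γ`, `G'_γ` or `G''_γ`: the row of index `i₀` is replaced by
the completeness equation of `γ`. -/
noncomputable def gluingMatrixCurve (e : I ≃ T.Edge) (i₀ : I) (γ : T.PeripheralCurve) (q : Fin 3) :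
    Matrix I I ℤ :=
  (T.gluingMatrix e q).updateRow i₀ (T.curveRow γ q)

/-- The three shape parameters of a tetrahedron. -/
noncomputable def shapeParam (w : ℂ) (q : Fin 3) : ℂ :=
  ![w, 1 / (1 - w), 1 - 1 / w] q

/-- `z` is a system of shapes in `ℂ ∖ {0, 1}` that solves the gluing equations of all edges and the
completeness equation of `γ`. -/
def IsShapeSolution [Fintype I] (γ : T.PeripheralCurve) (z : I → ℂ) : Prop :=
  (∀ j, z j ≠ 0 ∧ z j ≠ 1) ∧
  (∀ e : T.Edge, ∏ j, ∏ q, shapeParam (z j) q ^ T.incidence e j q = 1) ∧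
  ∏ j, ∏ q, shapeParam (z j) q ^ T.curveRow γ q j = 1

/-- The Neumann-Zagier datum of `T` with respect to `γ`: `A_γ = G_γ - G'_γ`, `B_γ = G''_γ - G'_γ`,
and `ν = η - G'_γ (1, …, 1)ᵗ` where `η` is `2` for edges and `0` for the curve `γ`. -/
noncomputable def nzDatum [Fintype I] (e : I ≃ T.Edge) (i₀ : I) (γ : T.PeripheralCurve)
    (z : I → ℂ) : NZDatum I where
  A := T.gluingMatrixCurve e i₀ γ 0 - T.gluingMatrixCurve e i₀ γ 1
  B := T.gluingMatrixCurve e i₀ γ 2 - T.gluingMatrixCurve e i₀ γ 1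
  ν i := (if i = i₀ then 0 else 2) - ∑ j, T.gluingMatrixCurve e i₀ γ 1 i j
  z := z

/-- The twisted gluing matrix `∑ₖ Gₖ tᵏ`: the entry `(i, j)` of `Gₖ` is the number of edges of
the translate `(j, k)` of the tetrahedron `j` which are incident in the infinite cyclic cover to
the lift `lift i` of the `i`-th edge and have a shape parameter of type `q`. -/
noncomputable def twistedGluingMatrix {T : IdealTriangulation I} (c : T.DualCocycle)
    (lift : I → c.infiniteCover.Edge) (q : Fin 3) : Matrix I I ℤ[T;T⁻¹] :=
  Matrix.of fun i j => ∑ᶠ k : ℤ,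
    LaurentPolynomial.C (c.infiniteCover.incidence (lift i) (j, k) q : ℤ) * LaurentPolynomial.T k

/-- The twisted Neumann-Zagier matrix `A(t)`. -/
noncomputable def twistedA {T : IdealTriangulation I} (c : T.DualCocycle)
    (lift : I → c.infiniteCover.Edge) : Matrix I I ℤ[T;T⁻¹] :=
  twistedGluingMatrix c lift 0 - twistedGluingMatrix c lift 1

/-- The twisted Neumann-Zagier matrix `B(t)`. -/
noncomputable def twistedB {T : IdealTriangulation I} (c : T.DualCocycle)
    (lift : I → c.infiniteCover.Edge) : Matrix I I ℤ[T;T⁻¹] :=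
  twistedGluingMatrix c lift 2 - twistedGluingMatrix c lift 1

end IdealTriangulation

/-- Evaluation of a matrix of Laurent polynomials at a nonzero complex number `t`. -/
noncomputable def laurentEval {J : Type*} (X : Matrix J J ℤ[T;T⁻¹]) (t : ℂˣ) : Matrix J J ℂ :=
  X.map (LaurentPolynomial.eval₂ (Int.castRingHom ℂ) t)

/-- The primitive root of unity `ω = exp(2πi/n)`. -/
noncomputable def rootOmega (n : ℕ) : ℂˣ :=
  Units.mk0 (Complex.exp (2 * Real.pi * Complex.I / n)) (Complex.exp_ne_zero _)

/-- The inverse propagator without the factor `1/ħ`: the matrix `- B⁻¹ A + Δ_{z'}`. -/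
noncomputable def quadraticForm {J : Type*} [Fintype J] [DecidableEq J] (A B : Matrix J J ℂ)
    (z : J → ℂ) : Matrix J J ℂ :=
  -(B⁻¹ * A) + Matrix.diagonal fun j => 1 / (1 - z j)

/-- The propagator `ħ (- B⁻¹ A + Δ_{z'})⁻¹`, with entries in `ℂ((ħ))`. -/
noncomputable def propagatorOf {J : Type*} [Fintype J] [DecidableEq J] (A B : Matrix J J ℂ)
    (z : J → ℂ) : Matrix J J (LaurentSeries ℂ) :=
  (quadraticForm A B z)⁻¹.map fun x => HahnSeries.single (1 : ℤ) x

/-! ### Feynman diagrams -/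

/-- A finite graph, possibly with self-loops and multiple edges, with a chosen orientation of
each edge: the edge `e` runs from the vertex `att e false` to the vertex `att e true`. -/
structure FeynmanGraph where
  nV : ℕ
  nE : ℕ
  att : Fin nE → Bool → Fin nV

namespace FeynmanGraph

/-- The degree of a vertex: the number of half-edges at it (a self-loop counts twice). -/
def degree (G : FeynmanGraph) (v : Fin G.nV) : ℕ :=
  (Finset.univ.filter fun h : Fin G.nE × Bool => G.att h.1 h.2 = v).card

def IsConnected (G : FeynmanGraph) : Prop :=
  0 < G.nV ∧
    ∀ v w, Relation.EqvGen (fun a b => ∃ e, a = G.att e false ∧ b = G.att e true) v w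

/-- The first Betti number of a connected graph. -/
def betti (G : FeynmanGraph) : ℕ := G.nE + 1 - G.nV

/-- The number of vertices of degree `k`. -/
def numVertices (G : FeynmanGraph) (k : ℕ) : ℕ :=
  (Finset.univ.filter fun v => G.degree v = k).card

/-- The same graph, with the orientation of the edges `e` with `s e = true` reversed. -/
def reorient (G : FeynmanGraph) (s : Fin G.nE → Bool) : FeynmanGraph where
  nV := G.nV
  nE := G.nE
  att e b := G.att e (xor b (s e))

/-- Isomorphisms of graphs, not required to respect the orientations: a bijection of the vertices
together with a bijection of the half-edges which is compatible with the pairing of half-edges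
into edges (i.e. a bijection of the edges and, for each edge, a choice of whether
its two ends are interchanged) and with the attaching maps. -/
def Iso (G G' : FeynmanGraph) : Type :=
  {p : (Fin G.nV ≃ Fin G'.nV) × (Fin G.nE ≃ Fin G'.nE) × (Fin G.nE → Bool) //
    ∀ e b, G'.att (p.2.1 e) (xor b (p.2.2 e)) = p.1 (G.att e b)}

/-- The symmetry factor of a graph: the order of its automorphism group. -/
noncomputable def symmetryFactor (G : FeynmanGraph) : ℕ := Nat.card (Iso G G)

/-- Graphs up to isomorphism. -/
instance isoSetoid : Setoid FeynmanGraph where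
  r G G' := Nonempty (Iso G G')
  iseqv :=
    { refl := fun G => ⟨⟨(Equiv.refl _, Equiv.refl _, fun _ => false), by simp⟩⟩
      symm := by
        rintro G G' ⟨⟨⟨σ, τ, s⟩, h⟩⟩
        refine ⟨⟨(σ.symm, τ.symm, fun e => s (τ.symm e)), fun e b => ?_⟩⟩
        have := h (τ.symm e) (xor b (s (τ.symm e)))
        simp only [Equiv.apply_symm_apply, Bool.xor_assoc, Bool.xor_self, Bool.xor_false] at this
        simp [this]
      trans := by
        rintro G G' G'' ⟨⟨⟨σ, τ, s⟩, h⟩⟩ ⟨⟨⟨σ', τ', s'⟩, h'⟩⟩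
        refine ⟨⟨(σ.trans σ', τ.trans τ', fun e => xor (s e) (s' (τ e))), fun e b => ?_⟩⟩
        have := h' (τ e) (xor b (s e))
        rw [h e b, Bool.xor_assoc] at this
        exact this }

/-- The connected graphs, with vertices of positive degree, that satisfy
`#(1-vertices) + #(2-vertices) + #(loops) ≤ ℓ`, the number of loops being the first
Betti number. -/
def IsDiagram (ℓ : ℕ) (G : FeynmanGraph) : Prop :=
  G.IsConnected ∧ (∀ v, 1 ≤ G.degree v) ∧ G.numVertices 1 + G.numVertices 2 + G.betti ≤ ℓ

/-- The set `𝒢_ℓ` of isomorphism classes of Feynman diagrams. -/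
def diagrams (ℓ : ℕ) : Set (Quotient isoSetoid) :=
  {g | ∃ G : FeynmanGraph, G.IsDiagram ℓ ∧ Quotient.mk isoSetoid G = g}

/-- `ℤ/n`-flows: at each vertex the sum over the incoming edges equals the sum over the outgoing
edges. -/
def IsFlow (G : FeynmanGraph) (n : ℕ) (φ : Fin G.nE → ZMod n) : Prop :=
  ∀ v, ∑ e ∈ Finset.univ.filter (fun e => G.att e true = v), φ e
    = ∑ e ∈ Finset.univ.filter (fun e => G.att e false = v), φ e

end FeynmanGraph

/-! ### Loop invariants -/

/-- The polylogarithm `Li_{-m}`, i.e. the rational function `(x d/dx)^m (x / (1 - x))`. -/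
noncomputable def negPolylog (m : ℕ) : ℂ → ℂ :=
  (fun (g : ℂ → ℂ) (x : ℂ) => x * deriv g x)^[m] fun x => x / (1 - x)

namespace NZDatum

variable {J : Type*} [Fintype J] [DecidableEq J] (D : NZDatum J)

/-- The matrix `A` with complex entries. -/
def Ac : Matrix J J ℂ := D.A.map (Int.cast : ℤ → ℂ)

/-- The matrix `B` with complex entries. -/
def Bc : Matrix J J ℂ := D.B.map (Int.cast : ℤ → ℂ)

/-- The inverse matrices in the definition of the propagator exist. -/
def IsNondegenerate : Prop :=
  IsUnit D.Bc.det ∧ IsUnit (quadraticForm D.Ac D.Bc D.z).det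

/-- Combinatorial flattenings `(f, f'')`, that is, integer solutions of `A f + B f'' = ν`. -/
def IsFlattening (f f'' : J → ℤ) : Prop := D.A.mulVec f + D.B.mulVec f'' = D.ν

/-- The propagator `Π_γ`. -/
noncomputable def propagator : Matrix J J (LaurentSeries ℂ) := propagatorOf D.Ac D.Bc D.z

/-- The vertex factor
`Γ_j^{(k)} = (-1)^k ∑_{p ≥ α_k} (B_p / p!) Li_{2-p-k}(1/z_j) ħ^{p-1} - [k = 1] (B⁻¹ν)_j / 2`
of a vertex of degree `k ≥ 1`, where `α_1 = α_2 = 1`, `α_k = 0` for `k ≥ 3` and `B_p` are the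
Bernoulli numbers with `B_1 = 1/2`. -/
noncomputable def vertexFactor (k : ℕ) (j : J) : LaurentSeries ℂ :=
  (-1) ^ k * (HahnSeries.single (-1 : ℤ) (1 : ℂ) *
      HahnSeries.ofPowerSeries ℤ ℂ (PowerSeries.mk fun p =>
        if p < (if k ≤ 2 then 1 else 0) then 0
        else ((bernoulli' p : ℚ) : ℂ) / (p.factorial : ℂ) * negPolylog (p + k - 2) (D.z j)⁻¹))
    - (if k = 1 then HahnSeries.C ((1 / 2 : ℂ) * D.Bc⁻¹.mulVec (fun i => (D.ν i : ℂ)) j) else 0)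

/-- The vacuum contribution
`Γ^{(0)} = (B_ℓ / ℓ!) ∑_j Li_{2-ℓ}(1/z_j) + [ℓ = 2] fᵗ B⁻¹ A f / 8` to the `ℓ`-loop
invariant, `ℓ ≥ 2`. -/
noncomputable def vacuum (f : J → ℤ) (ℓ : ℕ) : ℂ :=
  ((bernoulli' ℓ : ℚ) : ℂ) / (ℓ.factorial : ℂ) * ∑ j, negPolylog (ℓ - 2) (D.z j)⁻¹ +
    (if ℓ = 2 then
      (1 / 8 : ℂ) * ((fun j => (f j : ℂ)) ⬝ᵥ (D.Bc⁻¹ * D.Ac).mulVec fun j => (f j : ℂ)) else 0)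

/-- The Feynman weight of a graph with labelled vertices. -/
noncomputable def labelledWeight (G : FeynmanGraph) (ι : Fin G.nV → J) : LaurentSeries ℂ :=
  (∏ v, D.vertexFactor (G.degree v) (ι v)) *
    ∏ e, D.propagator (ι (G.att e false)) (ι (G.att e true))

/-- The Feynman weight `W(G)`. -/
noncomputable def weight (G : FeynmanGraph) : LaurentSeries ℂ :=
  (G.symmetryFactor : ℂ)⁻¹ • ∑ ι : Fin G.nV → J, D.labelledWeight G ι

/-- The `ℓ`-loop invariant, for `ℓ ≥ 2`: the coefficient of `ħ^{ℓ-1}` in the sum of the weights of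
the diagrams in `𝒢_ℓ`, plus the vacuum contribution. -/
noncomputable def loopInvariant (f : J → ℤ) (ℓ : ℕ) : ℂ :=
  (∑ᶠ g ∈ FeynmanGraph.diagrams ℓ, D.weight g.out).coeff ((ℓ : ℤ) - 1) + D.vacuum f ℓ

end NZDatum

/-! ### Weights of diagrams with flows -/

section FlowWeights

variable {I : Type*} [Fintype I] [DecidableEq I]

/-- The propagator of an edge that carries the flow value `k`: it is `Π_γ` if `k = 0`, and
`Π(ω^k) = ħ (- B(ω^k)⁻¹ A(ω^k) + Δ_{z'})⁻¹` otherwise. -/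
noncomputable def flowPropagator (D : NZDatum I) (At Bt : Matrix I I ℤ[T;T⁻¹]) (n : ℕ)
    (k : ZMod n) : Matrix I I (LaurentSeries ℂ) :=
  if k = 0 then D.propagator
  else propagatorOf (laurentEval At (rootOmega n ^ k.val)) (laurentEval Bt (rootOmega n ^ k.val))
    D.z

open Classical in
/-- The weight `W^{(n)}(G; ι)` of a graph with labelled vertices: a sum over all
`ℤ/n`-flows, divided by `n^{d-1}` with `d` the first Betti number of `G`. -/
noncomputable def labelledFlowWeight (D : NZDatum I) (At Bt : Matrix I I ℤ[T;T⁻¹]) (n : ℕ)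
    [NeZero n] (G : FeynmanGraph) (ι : Fin G.nV → I) : LaurentSeries ℂ :=
  (((n : ℂ) ^ ((G.betti : ℤ) - 1))⁻¹ : ℂ) •
    ∑ φ ∈ Finset.univ.filter (fun φ : Fin G.nE → ZMod n => G.IsFlow n φ),
      (∏ v, D.vertexFactor (G.degree v) (ι v)) *
        ∏ e, flowPropagator D At Bt n (φ e) (ι (G.att e false)) (ι (G.att e true))

/-- The weight `W^{(n)}(G)`. -/
noncomputable def flowWeight (D : NZDatum I) (At Bt : Matrix I I ℤ[T;T⁻¹]) (n : ℕ) [NeZero n]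
    (G : FeynmanGraph) : LaurentSeries ℂ :=
  (G.symmetryFactor : ℂ)⁻¹ • ∑ ι : Fin G.nV → I, labelledFlowWeight D At Bt n G ι

/-- The inverse matrices in the definition of `Π(t)` exist. -/
def IsNondegenerateAt (D : NZDatum I) (At Bt : Matrix I I ℤ[T;T⁻¹]) (t : ℂˣ) : Prop :=
  IsUnit (laurentEval Bt t).det ∧
    IsUnit (quadraticForm (laurentEval At t) (laurentEval Bt t) D.z).det

end FlowWeights

/-! ### Edges of a tetrahedron -/

namespace TetEdge

/-! The theorem is Fourier analysis for the action of `ZMod n` on the tetrahedra of the cover. The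
matrix `-B⁻¹A + Δ_{z'}` of the cover commutes with the deck group, so the characters of `ZMod n`
split it into blocks. The block of the trivial character is the inverse propagator of `T`; the block
of `k ≠ 0` is `-B(ω^k)⁻¹A(ω^k) + Δ_{z'}`. The blocks of an invertible matrix are invertible, and
Fourier inversion gives the propagator of the cover as `n⁻¹ ∑ₖ ω^{k(h-h')} Π_k`
(`inv_quadraticForm_apply`). Expanding a Feynman weight assigns a frequency to each edge of the
graph. Summing over the deck coordinates of the vertices kills all assignments that are not flows,
and leaves the factor `n^{V-E} = n^{-(d-1)}` (`sum_prod_fourier`). Vertex factors involve only the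
shapes and `B⁻¹ν`, which are deck-invariant.

Equivariance is the delicate point, since a Neumann-Zagier datum omits an edge and contains the row
of one lifted curve. The omitted edge does no harm, because the edge equations sum to zero
(`sum_edgeEq`). The edge equations alone determine `B⁻¹A v` up to a line spanned by a deck-invariant
vector `w₀` (`exists_kernel_generator`). The matrix `B⁻¹A` is symmetric by the Neumann-Zagier
relations, which are telescoping sums along curves and around edges; so a translation changes it by
`κ w₀ w₀ᵗ`. Iterating the translation `n` times gives the identity, whence `nκ = 0`
(`Matrix.IsSymm.apply_perm_of_sub_eq_mul`). On a nontrivial character the ambiguity along `w₀`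
disappears, and the edge equations, that is `A(t)` and `B(t)`, suffice. On the trivial character the
equation of the lifted curve is a nonzero multiple of that of `γ`.

The comparison of incidence numbers rests on the closedness of the cocycle: in the infinite cyclic
cover no edge of a tetrahedron is identified with another translate of itself
(`edgeMk_infiniteCover_injective`). -/

theorem image_image (σ τ : Equiv.Perm (Fin 4)) (s : TetEdge) :
    (s.image σ).image τ = s.image (τ * σ) := by
  apply Subtype.ext
  simp [TetEdge.image, Finset.map_map]
  rfl

theorem image_one (s : TetEdge) : s.image 1 = s := by
  apply Subtype.ext
  ext v
  simp [TetEdge.image, Equiv.Perm.one_def]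

theorem mem_image_iff (σ : Equiv.Perm (Fin 4)) (s : TetEdge) (v : Fin 4) :
    σ v ∈ (s.image σ).1 ↔ v ∈ s.1 := by
  simp [TetEdge.image]

/-- The edge with vertices `a` and `b`. -/
def of (a b : Fin 4) (h : a ≠ b) : TetEdge := ⟨{a, b}, Finset.card_pair h⟩

/-- The edge cut off by an arc or a flag. -/
abbrev ofFlag (p : Equiv.Perm (Fin 4)) : TetEdge := (of 0 1 (by decide)).image p

theorem ofFlag_val (p : Equiv.Perm (Fin 4)) : (ofFlag p).1 = {p 0, p 1} := by
  simp [ofFlag, of, TetEdge.image]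

end TetEdge

/-- The coefficients of the symplectic form of Neumann and Zagier on the exponents of
`z`, `z'`, `z''`. -/
def symplecticCoeff (q r : Fin 3) : ℤ :=
  !![0, -1, 1; 1, 0, -1; -1, 1, 0] q r

/-- The orientation orders the three types cyclically, so the two types other than that of `{p 0, p
1}` count with opposite signs, and each is carried by a pair of opposite edges. -/
theorem sign_mul_symplecticCoeff : ∀ (p : Equiv.Perm (Fin 4)) (s : TetEdge),
    ((Equiv.Perm.sign p : ℤˣ) : ℤ) * symplecticCoeff (shapeType s.1) (shapeType (TetEdge.ofFlag p).1)
      = (if s = (TetEdge.of 0 2 (by decide)).image p then 1 else 0)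
        + (if s = (TetEdge.of 1 3 (by decide)).image p then 1 else 0)
        - (if s = (TetEdge.of 0 3 (by decide)).image p then 1 else 0)
        - (if s = (TetEdge.of 1 2 (by decide)).image p then 1 else 0) := by
  decide +kernel

theorem sum_mul_symplecticCoeff (F : TetEdge → ℤ) (p : Equiv.Perm (Fin 4)) :
    ((Equiv.Perm.sign p : ℤˣ) : ℤ) *
      ∑ s, F s * symplecticCoeff (shapeType s.1) (shapeType (TetEdge.ofFlag p).1)
      = F ((TetEdge.of 0 2 (by decide)).image p) + F ((TetEdge.of 1 3 (by decide)).image p)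
        - F ((TetEdge.of 0 3 (by decide)).image p) - F ((TetEdge.of 1 2 (by decide)).image p) := by
  rw [Finset.mul_sum]
  have : ∀ s, ((Equiv.Perm.sign p : ℤˣ) : ℤ) *
      (F s * symplecticCoeff (shapeType s.1) (shapeType (TetEdge.ofFlag p).1)) =
      (if s = (TetEdge.of 0 2 (by decide)).image p then F s else 0)
        + (if s = (TetEdge.of 1 3 (by decide)).image p then F s else 0)
        - (if s = (TetEdge.of 0 3 (by decide)).image p then F s else 0)
        - (if s = (TetEdge.of 1 2 (by decide)).image p then F s else 0) := by
    intro s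
    rw [mul_left_comm, sign_mul_symplecticCoeff]
    simp only [mul_sub, mul_add, mul_ite, mul_one, mul_zero]
  simp only [this, Finset.sum_sub_distrib, Finset.sum_add_distrib, Finset.sum_ite_eq',
    Finset.mem_univ, if_true]

/-- The two even flags at an edge differ by `swap 0 1 * swap 2 3`: the edge is reversed and its two
faces are interchanged. -/
theorem card_evenFlags : ∀ s : TetEdge, (Finset.univ.filter fun p : Equiv.Perm (Fin 4) =>
    Equiv.Perm.sign p = 1 ∧ TetEdge.ofFlag p = s).card = 2 := by
  decide +kernel

theorem sum_evenFlags (F : TetEdge → ℤ) :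
    ∑ p : Equiv.Perm (Fin 4), (if Equiv.Perm.sign p = 1 then F (TetEdge.ofFlag p) else 0)
      = 2 * ∑ s, F s := by
  have h : ∀ p : Equiv.Perm (Fin 4), (if Equiv.Perm.sign p = 1 then F (TetEdge.ofFlag p) else 0)
      = ∑ s, if Equiv.Perm.sign p = 1 ∧ TetEdge.ofFlag p = s then F s else 0 := by
    intro p
    by_cases hp : Equiv.Perm.sign p = 1 <;> simp [hp]
  simp only [h]
  rw [Finset.sum_comm, Finset.mul_sum]
  refine Finset.sum_congr rfl fun s _ => ?_
  rw [← Finset.sum_filter, Finset.sum_const, card_evenFlags]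
  simp

theorem card_shapeType : ∀ q : Fin 3,
    (Finset.univ.filter fun s : TetEdge => shapeType s.1 = q).card = 2 := by
  decide +kernel

/-! ### The Neumann-Zagier symplectic relations -/

namespace IdealTriangulation

variable {I : Type*} (T : IdealTriangulation I)

theorem EdgeRel.symm {T : IdealTriangulation I} {x y : I × TetEdge} (h : T.EdgeRel x y) :
    T.EdgeRel y x := by
  obtain ⟨f, hf, rfl⟩ := h
  refine ⟨T.perm x.1 f f, ?_, ?_⟩
  · simpa [TetEdge.mem_image_iff] using hf
  · simp [T.nbr_nbr, T.perm_perm, TetEdge.image_image, TetEdge.image_one]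

/-- The edge of the triangulation represented by an edge of a tetrahedron. -/
def edgeMk (x : I × TetEdge) : T.Edge := Quot.mk T.EdgeRel x

theorem edgeMk_eq_of_notMem (j : I) (s : TetEdge) (f : Fin 4) (hf : f ∉ s.1) :
    T.edgeMk (T.nbr j f, s.image (T.perm j f)) = T.edgeMk (j, s) :=
  (Quot.sound ⟨f, hf, rfl⟩).symm

open Classical in
/-- The indicator function of the edges of tetrahedra in the class `E`. -/
noncomputable def edgeInd (E : T.Edge) (j : I) (s : TetEdge) : ℤ :=
  if T.edgeMk (j, s) = E then 1 else 0

theorem edgeInd_congr (E : T.Edge) {j j' : I} {s s' : TetEdge}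
    (h : T.edgeMk (j, s) = T.edgeMk (j', s')) : T.edgeInd E j s = T.edgeInd E j' s' := by
  unfold edgeInd
  rw [h]

theorem edgeInd_glue (E : T.Edge) (j : I) (s : TetEdge) (f : Fin 4) (hf : f ∉ s.1) :
    T.edgeInd E (T.nbr j f) (s.image (T.perm j f)) = T.edgeInd E j s :=
  T.edgeInd_congr E (T.edgeMk_eq_of_notMem j s f hf)

theorem incidence_eq_sum (E : T.Edge) (j : I) (q : Fin 3) :
    (T.incidence E j q : ℤ) = ∑ s : TetEdge, if shapeType s.1 = q then T.edgeInd E j s else 0 := by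
  classical
  simp only [incidence, Finset.card_filter]
  push_cast
  refine Finset.sum_congr rfl fun s _ => ?_
  show (if T.edgeMk (j, s) = E ∧ shapeType s.1 = q then (1 : ℤ) else 0) = _
  unfold edgeInd
  by_cases h : T.edgeMk (j, s) = E <;> by_cases h' : shapeType s.1 = q <;> simp [h, h']

/-- The contribution of the face through which a flag is left. -/
noncomputable def exitTerm (E : T.Edge) (j : I) (p : Equiv.Perm (Fin 4)) : ℤ :=
  T.edgeInd E j ((TetEdge.of 0 1 (by decide)).image p)
    + T.edgeInd E j ((TetEdge.of 0 2 (by decide)).image p)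
    - T.edgeInd E j ((TetEdge.of 1 2 (by decide)).image p)

/-- The contribution of the face through which a flag is entered. -/
noncomputable def entryTerm (E : T.Edge) (j : I) (p : Equiv.Perm (Fin 4)) : ℤ :=
  T.edgeInd E j ((TetEdge.of 0 1 (by decide)).image p)
    + T.edgeInd E j ((TetEdge.of 0 3 (by decide)).image p)
    - T.edgeInd E j ((TetEdge.of 1 3 (by decide)).image p)

theorem perm_cases : ∀ r : Equiv.Perm (Fin 4), r 0 = 0 → r 2 = 3 →
    ((TetEdge.of 0 1 (by decide)).image r = TetEdge.of 0 1 (by decide) ∧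
      (TetEdge.of 0 3 (by decide)).image r = TetEdge.of 0 2 (by decide) ∧
      (TetEdge.of 1 3 (by decide)).image r = TetEdge.of 1 2 (by decide)) ∨
    ((TetEdge.of 0 1 (by decide)).image r = TetEdge.of 0 2 (by decide) ∧
      (TetEdge.of 0 3 (by decide)).image r = TetEdge.of 0 1 (by decide) ∧
      (TetEdge.of 1 3 (by decide)).image r = TetEdge.of 1 2 (by decide)) := by
  decide +kernel

/-- `exitTerm` involves only the three edges of the face opposite to `p 3`, with a minus sign on the
one that misses the vertex `p 0`. It is thus a function of a face and a vertex of it, and the gluing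
identifies the edges of the two faces. The permutation `r` compares the labellings; it may exchange
the two remaining vertices of the face, which is the choice between turning left and right. -/
theorem exitTerm_eq_entryTerm (E : T.Edge) (j : I) (p q : Equiv.Perm (Fin 4))
    (h0 : q 0 = T.perm j (p 3) (p 0)) (h2 : q 2 = T.perm j (p 3) (p 3)) :
    T.exitTerm E j p = T.entryTerm E (T.nbr j (p 3)) q := by
  set σ := T.perm j (p 3)
  obtain ⟨r, rfl⟩ : ∃ r, q = σ * p * r := ⟨(σ * p)⁻¹ * q, by group⟩
  have h0' : r 0 = 0 := by simpa using h0
  have h2' : r 2 = 3 := by simpa using h2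
  have key : ∀ s : TetEdge, 3 ∉ s.1 →
      T.edgeInd E (T.nbr j (p 3)) (s.image (σ * p)) = T.edgeInd E j (s.image p) := by
    intro s hs
    rw [← TetEdge.image_image]
    exact T.edgeInd_glue E j _ _ (by rwa [TetEdge.mem_image_iff])
  have e1 := key (TetEdge.of 0 1 (by decide)) (by decide)
  have e2 := key (TetEdge.of 0 2 (by decide)) (by decide)
  have e3 := key (TetEdge.of 1 2 (by decide)) (by decide)
  unfold exitTerm entryTerm
  simp only [← TetEdge.image_image r (σ * p)]
  rcases perm_cases r h0' h2' with ⟨a, b, d⟩ | ⟨a, b, d⟩ <;> rw [a, b, d, e1, e2, e3] <;> ring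

/-- The symplectic pairing of the row of the edge `E` with the exponent vector of type `r` of
the tetrahedron `j`. -/
noncomputable def edgePairing (E : T.Edge) (j : I) (r : Fin 3) : ℤ :=
  ∑ q, symplecticCoeff q r * T.incidence E j q

theorem edgePairing_eq (E : T.Edge) (j : I) (r : Fin 3) :
    T.edgePairing E j r = ∑ s, T.edgeInd E j s * symplecticCoeff (shapeType s.1) r := by
  simp only [edgePairing, incidence_eq_sum, Finset.mul_sum]
  rw [Finset.sum_comm]
  refine Finset.sum_congr rfl fun s _ => ?_
  simp [mul_comm]

/-- The edge `{p 0, p 1}` occurs in both terms on the right and cancels; including it is what makes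
each term depend only on a face and a vertex. -/
theorem sign_mul_edgePairing (E : T.Edge) (j : I) (p : Equiv.Perm (Fin 4)) :
    ((Equiv.Perm.sign p : ℤˣ) : ℤ) * T.edgePairing E j (shapeType (TetEdge.ofFlag p).1)
      = T.exitTerm E j p - T.entryTerm E j p := by
  rw [edgePairing_eq, sum_mul_symplecticCoeff]
  unfold exitTerm entryTerm
  ring

/-- Each arc contributes its exit term minus its entry term, and the exit term of an arc is the
entry term of the next, so the sum over a closed curve telescopes. -/
theorem sum_edgePairing_curveRow [Fintype I] [DecidableEq I] (E : T.Edge) (γ : T.PeripheralCurve) :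
    ∑ j, ∑ r, T.edgePairing E j r * T.curveRow γ r j = 0 := by
  have h : ∑ j, ∑ r, T.edgePairing E j r * T.curveRow γ r j =
      ∑ i ∈ Finset.range γ.len,
        (T.exitTerm E (γ.tet i) (γ.arc i) - T.entryTerm E (γ.tet i) (γ.arc i)) := by
    simp only [curveRow, Finset.mul_sum]
    rw [Finset.sum_congr rfl fun j _ => Finset.sum_comm, Finset.sum_comm]
    refine Finset.sum_congr rfl fun i _ => ?_
    rw [← sign_mul_edgePairing, ← TetEdge.ofFlag_val, Finset.sum_eq_single (γ.tet i)
      (by intro j _ hj; simp [hj.symm]) (by simp),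
      Finset.sum_eq_single (shapeType (TetEdge.ofFlag (γ.arc i)).1)
      (by intro q _ hq; simp [hq.symm]) (by simp)]
    simp [mul_comm]
  rw [h]
  have hstep : ∀ i, T.exitTerm E (γ.tet i) (γ.arc i)
      = T.entryTerm E (γ.tet (i + 1)) (γ.arc (i + 1)) := by
    intro i
    rw [γ.tet_succ]
    exact T.exitTerm_eq_entryTerm E _ _ _ (γ.vertex_succ i) (γ.face_succ i)
  simp only [hstep]
  rw [Finset.sum_range_sub (fun i => T.entryTerm E (γ.tet i) (γ.arc i))]
  have h1 := γ.tet_periodic 0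
  have h2 := γ.arc_periodic 0
  rw [zero_add] at h1 h2
  rw [h1, h2, sub_self]

/-- The flag from which a flag is reached by `rot`. -/
def rotInv (x : I × Equiv.Perm (Fin 4)) : I × Equiv.Perm (Fin 4) :=
  (T.nbr x.1 (x.2 2), T.perm x.1 (x.2 2) * x.2 * Equiv.swap 2 3)

theorem rotInv_rot (x : I × Equiv.Perm (Fin 4)) : T.rotInv (T.rot x) = x := by
  obtain ⟨j, p⟩ := x
  simp only [rotInv, rot, Equiv.Perm.mul_apply, Equiv.swap_apply_left, T.nbr_nbr, T.perm_perm]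
  simp [← mul_assoc]

theorem rot_rotInv (x : I × Equiv.Perm (Fin 4)) : T.rot (T.rotInv x) = x := by
  obtain ⟨j, p⟩ := x
  simp only [rotInv, rot, Equiv.Perm.mul_apply, Equiv.swap_apply_right, T.nbr_nbr, T.perm_perm]
  simp [← mul_assoc]

/-- Rotation about an edge as a permutation of the flags. -/
def rotEquiv : Equiv.Perm (I × Equiv.Perm (Fin 4)) where
  toFun := T.rot
  invFun := T.rotInv
  left_inv := T.rotInv_rot
  right_inv := T.rot_rotInv

theorem sign_rot (x : I × Equiv.Perm (Fin 4)) :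
    Equiv.Perm.sign (T.rot x).2 = Equiv.Perm.sign x.2 := by
  simp [rot, T.sign_perm]

theorem edgeMk_rot (x : I × Equiv.Perm (Fin 4)) :
    T.edgeMk ((T.rot x).1, TetEdge.ofFlag (T.rot x).2)
      = T.edgeMk (x.1, TetEdge.ofFlag x.2) := by
  obtain ⟨j, p⟩ := x
  simp only [rot, TetEdge.ofFlag, ← TetEdge.image_image _ (T.perm j (p 3) * p),
    show (TetEdge.of 0 1 (by decide)).image (Equiv.swap 2 3) = TetEdge.of 0 1 (by decide) by
      decide +kernel]
  rw [← TetEdge.image_image]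
  exact T.edgeMk_eq_of_notMem j _ _ (by rw [TetEdge.mem_image_iff]; decide)

/-- Loops around `E'` replace the curve: `rot` permutes the even flags at `E'` and turns exit terms
into entry terms. Each edge of a tetrahedron carries two even flags, whence the factor `2` in the
proof. -/
theorem sum_edgePairing_incidence [Fintype I] (E E' : T.Edge) :
    ∑ j, ∑ r, T.edgePairing E j r * (T.incidence E' j r : ℤ) = 0 := by
  have h : 2 * ∑ j, ∑ r, T.edgePairing E j r * (T.incidence E' j r : ℤ) =
      ∑ x : I × Equiv.Perm (Fin 4), if Equiv.Perm.sign x.2 = 1 then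
        T.edgeInd E' x.1 (TetEdge.ofFlag x.2) * (T.exitTerm E x.1 x.2 - T.entryTerm E x.1 x.2)
        else 0 := by
    rw [Fintype.sum_prod_type, Finset.mul_sum]
    refine Finset.sum_congr rfl fun j _ => ?_
    simp only [incidence_eq_sum, Finset.mul_sum]
    rw [Finset.sum_comm]
    have := sum_evenFlags fun s => T.edgeInd E' j s * T.edgePairing E j (shapeType s.1)
    rw [Finset.mul_sum] at this
    refine Eq.trans (Finset.sum_congr rfl fun s _ => ?_) (this.symm.trans
      (Finset.sum_congr rfl fun p _ => ?_))
    · simp [mul_comm]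
    · split_ifs with hp
      · rw [← sign_mul_edgePairing, hp]
        simp
      · rfl
  have h2 : (∑ x : I × Equiv.Perm (Fin 4), if Equiv.Perm.sign x.2 = 1 then
        T.edgeInd E' x.1 (TetEdge.ofFlag x.2) * T.exitTerm E x.1 x.2 else 0) =
      ∑ x : I × Equiv.Perm (Fin 4), if Equiv.Perm.sign x.2 = 1 then
        T.edgeInd E' x.1 (TetEdge.ofFlag x.2) * T.entryTerm E x.1 x.2 else 0 := by
    rw [← Equiv.sum_comp T.rotEquiv (fun x => if Equiv.Perm.sign x.2 = 1 then
        T.edgeInd E' x.1 (TetEdge.ofFlag x.2) * T.entryTerm E x.1 x.2 else 0)]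
    refine Finset.sum_congr rfl fun x _ => ?_
    show _ = if Equiv.Perm.sign (T.rot x).2 = 1 then
        T.edgeInd E' (T.rot x).1 (TetEdge.ofFlag (T.rot x).2) *
          T.entryTerm E (T.rot x).1 (T.rot x).2 else 0
    rw [T.sign_rot, T.exitTerm_eq_entryTerm E x.1 x.2 (T.rot x).2
      (by simp [rot, Equiv.swap_apply_of_ne_of_ne]) (by simp [rot])]
    rw [T.edgeInd_congr E' (T.edgeMk_rot x)]
    rfl
  have h3 : 2 * ∑ j, ∑ r, T.edgePairing E j r * (T.incidence E' j r : ℤ) = 0 := by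
    rw [h]
    refine Eq.trans ?_ (sub_eq_zero.mpr h2)
    rw [← Finset.sum_sub_distrib]
    refine Finset.sum_congr rfl fun x _ => ?_
    split_ifs <;> ring
  simpa using h3

theorem sum_incidence [Fintype T.Edge] (j : I) (q : Fin 3) :
    ∑ E : T.Edge, (T.incidence E j q : ℤ) = 2 := by
  classical
  simp only [incidence_eq_sum]
  rw [Finset.sum_comm]
  have : ∀ s : TetEdge, (∑ E : T.Edge, if shapeType s.1 = q then T.edgeInd E j s else 0)
      = if shapeType s.1 = q then 1 else 0 := by
    intro s
    split_ifs <;> simp [edgeInd]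
  simp only [this]
  rw [← Finset.sum_filter, Finset.sum_const, card_shapeType]
  rfl

end IdealTriangulation

namespace IdealTriangulation

variable {I : Type*} {T : IdealTriangulation I}

/-! ### Rotation about an edge -/

/-- The flag with the same edge traversed backwards and the two faces at it interchanged. -/
def reverseFlag (x : I × Equiv.Perm (Fin 4)) : I × Equiv.Perm (Fin 4) :=
  (x.1, x.2 * (Equiv.swap 0 1 * Equiv.swap 2 3))

/-- Seen from the reversed edge, rotation runs backwards: `reverseFlag` conjugates `rot` to its
inverse. -/
theorem rot_reverseFlag_rot (x : I × Equiv.Perm (Fin 4)) :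
    T.rot (reverseFlag (T.rot x)) = reverseFlag x := by
  obtain ⟨j, p⟩ := x
  have h : (p * Equiv.swap 2 3 * (Equiv.swap 0 1 * Equiv.swap 2 3) * Equiv.swap 2 3) =
      p * (Equiv.swap 0 1 * Equiv.swap 2 3) := by
    rw [mul_assoc, mul_assoc]
    congr 1
    decide +kernel
  have h3 : (Equiv.swap (2 : Fin 4) 3) ((Equiv.swap (0 : Fin 4) 1)
      ((Equiv.swap (2 : Fin 4) 3) 3)) = 3 := by decide
  simp only [rot, reverseFlag, Equiv.Perm.mul_apply, h3, T.nbr_nbr, T.perm_perm]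
  rw [← h]
  simp [mul_assoc]

theorem rot_ne_reverseFlag (x : I × Equiv.Perm (Fin 4)) : T.rot x ≠ reverseFlag x := by
  obtain ⟨j, p⟩ := x
  intro h
  simp only [rot, reverseFlag, Prod.mk.injEq] at h
  apply T.ne_self j (p 3)
  rw [h.1]
  have := congrArg (fun σ : Equiv.Perm (Fin 4) => σ 2) h.2
  have e : (Equiv.swap (0 : Fin 4) 1) 3 = 3 := by decide
  simp [e] at this
  rw [this]

theorem reverseFlag_ne (x : I × Equiv.Perm (Fin 4)) : x ≠ reverseFlag x := by
  obtain ⟨j, p⟩ := x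
  intro h
  simp only [reverseFlag, Prod.mk.injEq, true_and] at h
  exact absurd (mul_left_cancel ((mul_one p).trans h)) (by decide +kernel)

/-- An edge is never folded onto its own reverse. Since `reverseFlag` inverts `rot`, a coincidence
for `x` after `m + 2` steps gives one for `rot x` after `m` steps. The descent ends at `m = 0`, or
at `m = 1`, where a face would be glued to itself. -/
theorem iterate_rot_ne_reverseFlag (m : ℕ) (x : I × Equiv.Perm (Fin 4)) :
    T.rot^[m] x ≠ reverseFlag x := by
  induction m using Nat.twoStepInduction generalizing x with
  | zero => exact reverseFlag_ne x
  | one => exact rot_ne_reverseFlag x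
  | more m ih _ =>
    intro h
    rw [Function.iterate_succ_apply', Function.iterate_succ_apply, ← rot_reverseFlag_rot] at h
    have := T.rotEquiv.injective (a₁ := T.rot^[m + 1] x) (a₂ := reverseFlag (T.rot x))
    rw [Function.iterate_succ_apply] at this
    exact ih (T.rot x) (this h)

theorem sign_iterate_rot (m : ℕ) (x : I × Equiv.Perm (Fin 4)) :
    Equiv.Perm.sign (T.rot^[m] x).2 = Equiv.Perm.sign x.2 := by
  induction m with
  | zero => rfl
  | succ m ih => rw [Function.iterate_succ_apply', T.sign_rot, ih]

theorem exists_iterate_rot_eq [Finite I] (x : I × Equiv.Perm (Fin 4)) :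
    ∃ m : ℕ, T.rot^[m + 1] x = x := by
  obtain ⟨m, hm, h⟩ := (isOfFinOrder_of_finite T.rotEquiv).exists_pow_eq_one
  refine ⟨m - 1, ?_⟩
  rw [Nat.sub_add_cancel hm]
  have := congrArg (fun σ : Equiv.Perm (I × Equiv.Perm (Fin 4)) => σ x) h
  simp only [Equiv.Perm.coe_one, id] at this
  rw [← Equiv.Perm.iterate_eq_pow] at this
  exact this

theorem flag_of_edge_eq : ∀ r : Equiv.Perm (Fin 4), Equiv.Perm.sign r = 1 →
    TetEdge.ofFlag r = TetEdge.of 0 1 (by decide) →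
    r = 1 ∨ r = Equiv.swap 0 1 * Equiv.swap 2 3 := by
  decide +kernel

theorem _root_.TetEdge.exists_ofFlag : ∀ s : TetEdge, ∃ p, TetEdge.ofFlag p = s := by
  decide +kernel

theorem _root_.TetEdge.notMem_ofFlag (p : Equiv.Perm (Fin 4)) (f : Fin 4)
    (h : f ∉ (TetEdge.ofFlag p).1) : f = p 2 ∨ f = p 3 := by
  obtain ⟨i, rfl⟩ := p.surjective f
  rw [TetEdge.mem_image_iff] at h
  revert h
  fin_cases i <;> simp [TetEdge.of]

namespace DualCocycle

/-! ### Edges of covers -/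

section Cover

variable {H : Type*} [AddCommGroup H] (c : T.DualCocycle) (φ : ℤ →+ H)

/-- The action of the deck group on the edges of a cover. -/
def deck (l : H) : (c.cover φ).Edge → (c.cover φ).Edge :=
  Quot.map (fun x => ((x.1.1, x.1.2 + l), x.2)) (by
    rintro ⟨⟨j, h⟩, s⟩ y ⟨f, hf, rfl⟩
    exact ⟨f, hf, by simp [cover, add_right_comm]⟩)

theorem deck_edgeMk (l h : H) (j : I) (s : TetEdge) :
    c.deck φ l ((c.cover φ).edgeMk ((j, h), s)) = (c.cover φ).edgeMk ((j, h + l), s) := rfl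

/-- The projection from the edges of the infinite cyclic cover to those of a quotient. -/
def toCover : c.infiniteCover.Edge → (c.cover φ).Edge :=
  Quot.map (fun x => ((x.1.1, φ x.1.2), x.2)) (by
    rintro ⟨⟨j, h⟩, s⟩ y ⟨f, hf, rfl⟩
    exact ⟨f, hf, by simp [cover]⟩)

theorem toCover_edgeMk (m : ℤ) (j : I) (s : TetEdge) :
    c.toCover φ (c.infiniteCover.edgeMk ((j, m), s)) = (c.cover φ).edgeMk ((j, φ m), s) := rfl

theorem coverProj_edgeMk (h : H) (j : I) (s : TetEdge) :
    c.coverProj φ ((c.cover φ).edgeMk ((j, h), s)) = T.edgeMk (j, s) := rfl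

/-- Two edges of tetrahedra are identified along a path on which the cocycle takes
the value `d`. -/
def PathRel (x y : I × TetEdge) (d : ℤ) : Prop :=
  c.infiniteCover.edgeMk ((x.1, 0), x.2) = c.infiniteCover.edgeMk ((y.1, d), y.2)

variable {c}

theorem pathRel_iff (x y : I × TetEdge) (m m' : ℤ) :
    c.infiniteCover.edgeMk ((x.1, m), x.2) = c.infiniteCover.edgeMk ((y.1, m'), y.2) ↔
      c.PathRel x y (m' - m) := by
  constructor
  · intro h
    have := congrArg (c.deck (AddMonoidHom.id ℤ) (-m)) h
    rw [deck_edgeMk, deck_edgeMk] at this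
    simpa [PathRel, sub_eq_add_neg] using this
  · intro h
    have := congrArg (c.deck (AddMonoidHom.id ℤ) m) h
    rw [deck_edgeMk, deck_edgeMk] at this
    simpa using this

theorem PathRel.symm {x y : I × TetEdge} {d : ℤ} (h : c.PathRel x y d) :
    c.PathRel y x (-d) := by
  have := (pathRel_iff y x d 0).1 (Eq.symm h)
  simpa using this

theorem PathRel.trans {x y w : I × TetEdge} {d d' : ℤ} (h : c.PathRel x y d)
    (h' : c.PathRel y w d') : c.PathRel x w (d + d') := by
  have := (pathRel_iff y w d (d + d')).2 (by simpa using h')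
  exact Eq.trans h this

theorem pathRel_glue (j : I) (s : TetEdge) (f : Fin 4) (hf : f ∉ s.1) :
    c.PathRel (j, s) (T.nbr j f, s.image (T.perm j f)) (c.val j f) := by
  have := c.infiniteCover.edgeMk_eq_of_notMem (j, 0) s f hf
  simpa [cover, PathRel] using this.symm

/-- A chain of identifications in `T` lifts to the cover, where the second coordinate moves by `φ`
of the cocycle. The single relation `PathRel` therefore governs the edges of all covers. -/
theorem edgeMk_cover_eq_iff (x y : I × TetEdge) (h h' : H) :
    (c.cover φ).edgeMk ((x.1, h), x.2) = (c.cover φ).edgeMk ((y.1, h'), y.2) ↔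
      ∃ d, c.PathRel x y d ∧ h' = h + φ d := by
  constructor
  · intro he
    have key : ∀ X Y : (I × H) × TetEdge, Relation.EqvGen (c.cover φ).EdgeRel X Y →
        ∃ d, c.PathRel (X.1.1, X.2) (Y.1.1, Y.2) d ∧ Y.1.2 = X.1.2 + φ d := by
      intro X Y hXY
      induction hXY with
      | rel X Y hr =>
        obtain ⟨f, hf, rfl⟩ := hr
        exact ⟨_, pathRel_glue _ _ f hf, rfl⟩
      | refl X => exact ⟨0, rfl, by simp⟩
      | symm X Y _ ih =>
        obtain ⟨d, hd, e⟩ := ih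
        exact ⟨-d, hd.symm, by simp [e]⟩
      | trans X Y Z _ _ ih ih' =>
        obtain ⟨d, hd, e⟩ := ih
        obtain ⟨d', hd', e'⟩ := ih'
        exact ⟨d + d', hd.trans hd', by simp [e, e', add_assoc]⟩
    exact key _ _ (Quot.eqvGen_exact he)
  · rintro ⟨d, hd, rfl⟩
    have := congrArg (c.deck φ h) (congrArg (c.toCover φ) hd)
    rw [toCover_edgeMk, toCover_edgeMk, deck_edgeMk, deck_edgeMk] at this
    simpa [add_comm] using this

theorem edgeMk_eq_iff_exists_pathRel (x y : I × TetEdge) :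
    T.edgeMk x = T.edgeMk y ↔ ∃ d, c.PathRel x y d := by
  constructor
  · intro he
    have key : ∀ X Y : I × TetEdge, Relation.EqvGen T.EdgeRel X Y → ∃ d, c.PathRel X Y d := by
      intro X Y hXY
      induction hXY with
      | rel X Y hr =>
        obtain ⟨f, hf, rfl⟩ := hr
        exact ⟨_, pathRel_glue _ _ f hf⟩
      | refl X => exact ⟨0, rfl⟩
      | symm X Y _ ih =>
        obtain ⟨d, hd⟩ := ih
        exact ⟨-d, hd.symm⟩
      | trans X Y Z _ _ ih ih' =>
        obtain ⟨d, hd⟩ := ih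
        obtain ⟨d', hd'⟩ := ih'
        exact ⟨d + d', hd.trans hd'⟩
    exact key _ _ (Quot.eqvGen_exact he)
  · rintro ⟨d, hd⟩
    exact congrArg (c.coverProj (AddMonoidHom.id ℤ)) hd

variable (c) in
theorem edgeMk_eq_toCover_iff (ε : c.infiniteCover.Edge) (j : I) (h : H) (s : TetEdge) :
    (c.cover φ).edgeMk ((j, h), s) = c.toCover φ ε ↔
      ∃ m : ℤ, c.infiniteCover.edgeMk ((j, m), s) = ε ∧ φ m = h := by
  obtain ⟨⟨⟨j', m'⟩, s'⟩, rfl⟩ := Quot.exists_rep ε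
  change _ = c.toCover φ (c.infiniteCover.edgeMk ((j', m'), s')) ↔
    ∃ m : ℤ, _ = c.infiniteCover.edgeMk ((j', m'), s') ∧ _
  rw [toCover_edgeMk, edgeMk_cover_eq_iff φ (j, s) (j', s')]
  constructor
  · rintro ⟨d, hd, e⟩
    refine ⟨m' - d, (pathRel_iff (j, s) (j', s') _ _).2 (by simpa using hd), ?_⟩
    simp [e]
  · rintro ⟨m, hm, rfl⟩
    exact ⟨_, (pathRel_iff (j, s) (j', s') _ _).1 hm, by simp⟩

variable (c) in
theorem edgeMk_eq_coverProj_iff (ε : c.infiniteCover.Edge) (j : I) (s : TetEdge) :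
    T.edgeMk (j, s) = c.coverProj (AddMonoidHom.id ℤ) ε ↔
      ∃ m : ℤ, c.infiniteCover.edgeMk ((j, m), s) = ε := by
  obtain ⟨⟨⟨j', m'⟩, s'⟩, rfl⟩ := Quot.exists_rep ε
  change _ = c.coverProj (AddMonoidHom.id ℤ) (c.infiniteCover.edgeMk ((j', m'), s')) ↔
    ∃ m : ℤ, _ = c.infiniteCover.edgeMk ((j', m'), s')
  rw [coverProj_edgeMk, edgeMk_eq_iff_exists_pathRel (c := c)]
  constructor
  · rintro ⟨d, hd⟩
    exact ⟨m' - d, (pathRel_iff (j, s) (j', s') _ _).2 (by simpa using hd)⟩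
  · rintro ⟨m, hm⟩
    exact ⟨_, (pathRel_iff (j, s) (j', s') _ _).1 hm⟩

variable (c) in
/-- The value of the cocycle on an initial segment of a rotation. -/
def rotSum (x : I × Equiv.Perm (Fin 4)) (m : ℕ) : ℤ :=
  ∑ i ∈ Finset.range m, c.val (T.rot^[i] x).1 ((T.rot^[i] x).2 3)

theorem rotSum_succ (x : I × Equiv.Perm (Fin 4)) (m : ℕ) :
    c.rotSum x (m + 1) = c.rotSum x m + c.val (T.rot^[m] x).1 ((T.rot^[m] x).2 3) :=
  Finset.sum_range_succ _ _

theorem rotSum_add (x : I × Equiv.Perm (Fin 4)) (m r : ℕ) :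
    c.rotSum x (m + r) = c.rotSum x m + c.rotSum (T.rot^[m] x) r := by
  simp only [rotSum, Finset.sum_range_add, ← Function.iterate_add_apply, add_comm]

/-- The value of the cocycle on a path that identifies the edge of a flag with another edge is that
of a rotation. -/
theorem exists_rot_of_pathRel [Finite I] (x : I × Equiv.Perm (Fin 4)) (y : I × TetEdge) (d : ℤ)
    (h : c.PathRel (x.1, TetEdge.ofFlag x.2) y d) :
    ∃ m : ℕ, (T.rot^[m] x).1 = y.1 ∧ TetEdge.ofFlag (T.rot^[m] x).2 = y.2 ∧
      c.rotSum x m = d := by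
  let Q : (I × ℤ) × TetEdge → Prop := fun X =>
    ∃ m : ℕ, (T.rot^[m] x).1 = X.1.1 ∧ TetEdge.ofFlag (T.rot^[m] x).2 = X.2 ∧
      c.rotSum x m = X.1.2
  have step : ∀ X Y, c.infiniteCover.EdgeRel X Y → Q X → Q Y := by
    rintro ⟨⟨j, h⟩, s⟩ Y ⟨f, hf, rfl⟩ ⟨m, hj, hs, hd⟩
    dsimp only at hj hs hd hf
    subst hj hs hd
    rcases TetEdge.notMem_ofFlag _ f hf with rfl | rfl
    -- Crossing the other face at the edge is a step of `rotInv`. As `I` is finite, `rot` has a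
    -- period `M + 1` at this flag, so the step is `M` rotations forward; closedness gives both the
    -- same cocycle value.
    · obtain ⟨M, hM⟩ := exists_iterate_rot_eq (T := T) (T.rot^[m] x)
      have hinv : T.rot^[m + M] x = T.rotInv (T.rot^[m] x) := by
        rw [Function.iterate_succ_apply', ← Function.iterate_add_apply, add_comm M m] at hM
        rw [← hM, T.rotInv_rot]
      have hclosed := c.closed _ _ hM
      refine ⟨m + M, ?_, ?_, ?_⟩
      · rw [hinv]; rfl
      · rw [hinv]
        simp only [rotInv, TetEdge.ofFlag, cover]
        rw [← TetEdge.image_image, ← TetEdge.image_image,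
          show (TetEdge.of 0 1 (by decide)).image (Equiv.swap 2 3) = TetEdge.of 0 1 (by decide) by
          decide +kernel]
      · have h1 : c.rotSum x (m + M) + c.val (T.rot^[m + M] x).1 ((T.rot^[m + M] x).2 3)
            = c.rotSum x m := by
          rw [← rotSum_succ, add_assoc, rotSum_add]
          simpa [rotSum] using hclosed
        rw [hinv] at h1
        simp only [rotInv, Equiv.Perm.mul_apply, Equiv.swap_apply_right, c.antisymm] at h1
        simp only [cover, AddMonoidHom.id_apply]
        linarith
    · refine ⟨m + 1, ?_, ?_, ?_⟩
      · rw [Function.iterate_succ_apply']; rfl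
      · rw [Function.iterate_succ_apply']
        simp only [rot, TetEdge.ofFlag, cover]
        rw [← TetEdge.image_image, ← TetEdge.image_image,
          show (TetEdge.of 0 1 (by decide)).image (Equiv.swap 2 3) = TetEdge.of 0 1 (by decide) by
          decide +kernel]
      · rw [rotSum_succ]; rfl
  have hQ : ∀ X Y, c.infiniteCover.EdgeRel X Y → Q X = Q Y := fun X Y hr =>
    propext ⟨step X Y hr, step Y X hr.symm⟩
  have := congrArg (Quot.lift Q hQ) h
  change Q ((x.1, 0), TetEdge.ofFlag x.2) = Q ((y.1, d), y.2) at this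
  exact this.mp ⟨0, rfl, rfl, by simp [rotSum]⟩

/-- The path can be taken to be a rotation that ends at a flag with the same tetrahedron, edge and
sign. Either the flag has returned, and the cocycle is closed, or it is reversed, which
`iterate_rot_ne_reverseFlag` excludes. -/
theorem PathRel.eq_zero [Finite I] {x : I × TetEdge} {d : ℤ} (h : c.PathRel x x d) : d = 0 := by
  obtain ⟨j, s⟩ := x
  obtain ⟨p, rfl⟩ := TetEdge.exists_ofFlag s
  obtain ⟨m, hj, hs, rfl⟩ := exists_rot_of_pathRel (j, p) _ d h
  have hsign := sign_iterate_rot (T := T) m (j, p)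
  obtain ⟨r, hr⟩ : ∃ r, (T.rot^[m] (j, p)).2 = p * r := ⟨p⁻¹ * (T.rot^[m] (j, p)).2, by group⟩
  rw [hr] at hs hsign
  have hr1 : Equiv.Perm.sign r = 1 := by simpa using hsign
  have hr2 : TetEdge.ofFlag r = TetEdge.of 0 1 (by decide) := by
    have := congrArg (TetEdge.image p⁻¹) hs
    simpa [TetEdge.image_image, TetEdge.image_one] using this
  rcases flag_of_edge_eq r hr1 hr2 with rfl | rfl
  · exact c.closed (j, p) m (Prod.ext hj (by rw [hr, mul_one]))
  · exact absurd (Prod.ext hj hr) (iterate_rot_ne_reverseFlag m (j, p))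

theorem edgeMk_infiniteCover_injective [Finite I] (j : I) (s : TetEdge) {m m' : ℤ}
    (h : c.infiniteCover.edgeMk ((j, m), s) = c.infiniteCover.edgeMk ((j, m'), s)) : m = m' := by
  have := ((pathRel_iff (j, s) (j, s) m m').1 h).eq_zero
  omega

theorem incidence_deck (l : H) (E : (c.cover φ).Edge) (j : I) (h : H) (q : Fin 3) :
    (c.cover φ).incidence (c.deck φ l E) (j, h + l) q = (c.cover φ).incidence E (j, h) q := by
  have hinj : Function.LeftInverse (c.deck φ (-l)) (c.deck φ l) := by
    intro E
    obtain ⟨⟨⟨j', h'⟩, s'⟩, rfl⟩ := Quot.exists_rep E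
    change c.deck φ (-l) (c.deck φ l ((c.cover φ).edgeMk ((j', h'), s'))) =
      (c.cover φ).edgeMk ((j', h'), s')
    simp [deck_edgeMk]
  unfold incidence
  congr 1
  ext s
  simp only [Finset.mem_filter, Finset.mem_univ, true_and]
  refine and_congr_left fun _ => ?_
  exact hinj.injective.eq_iff (a := (c.cover φ).edgeMk ((j, h), s))

theorem exists_deck_toCover {ι : Type*} {lift : ι → c.infiniteCover.Edge}
    (hlift : Function.Surjective fun i => c.coverProj (AddMonoidHom.id ℤ) (lift i)) (E : (c.cover φ).Edge) :
    ∃ i l, E = c.deck φ l (c.toCover φ (lift i)) := by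
  obtain ⟨⟨⟨j, h⟩, s⟩, rfl⟩ := Quot.exists_rep E
  obtain ⟨i, hi⟩ := hlift (T.edgeMk (j, s))
  obtain ⟨m, hm⟩ := (c.edgeMk_eq_coverProj_iff (lift i) j s).1 hi.symm
  refine ⟨i, h - φ m, ?_⟩
  rw [← hm, toCover_edgeMk, deck_edgeMk, add_sub_cancel]
  rfl

end Cover

/-! ### Incidence numbers of the cyclic covers -/

section Cyclic

variable (c : T.DualCocycle) (n : ℕ)

open Classical in
theorem edgeInd_toCover (ε : c.infiniteCover.Edge) (j : I) (h : ZMod n) (s : TetEdge) :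
    (c.cyclicCover n).edgeInd (c.toCover (Int.castAddHom (ZMod n)) ε) (j, h) s =
      if ∃ m : ℤ, c.infiniteCover.edgeMk ((j, m), s) = ε ∧ (m : ZMod n) = h then 1 else 0 := by
  unfold edgeInd
  simp only [edgeMk_eq_toCover_iff, Int.coe_castAddHom]

variable [NeZero n]

theorem sum_curveRow_liftCurve [DecidableEq I] (γ : T.PeripheralCurve) (a : ZMod n) (q : Fin 3)
    (j : I) :
    ∑ h, (c.cyclicCover n).curveRow (c.liftCurve n γ a) q (j, h) =
      addOrderOf (c.eval γ : ZMod n) * T.curveRow γ q j := by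
  have h1 : ∑ h, (c.cyclicCover n).curveRow (c.liftCurve n γ a) q (j, h) =
      ∑ i ∈ Finset.range (addOrderOf (c.eval γ : ZMod n) * γ.len),
        if γ.tet i = j ∧ shapeType {γ.arc i 0, γ.arc i 1} = q then
          ((Equiv.Perm.sign (γ.arc i) : ℤˣ) : ℤ) else 0 := by
    simp only [curveRow, liftCurve]
    rw [Finset.sum_comm]
    refine Finset.sum_congr rfl fun i _ => ?_
    rw [Finset.sum_eq_single (a + (c.partialEval γ i : ZMod n))]
    · simp
    · intro h _ hne
      refine if_neg ?_
      rintro ⟨h1, -⟩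
      exact hne (Prod.ext_iff.1 h1).2.symm
    · simp
  rw [h1]
  generalize addOrderOf (c.eval γ : ZMod n) = r
  have htet : ∀ r i, γ.tet (r * γ.len + i) = γ.tet i := by
    intro r i
    induction r with
    | zero => simp
    | succ r ih =>
      rw [show (r + 1) * γ.len + i = r * γ.len + i + γ.len by ring, γ.tet_periodic, ih]
  have harc : ∀ r i, γ.arc (r * γ.len + i) = γ.arc i := by
    intro r i
    induction r with
    | zero => simp
    | succ r ih =>
      rw [show (r + 1) * γ.len + i = r * γ.len + i + γ.len by ring, γ.arc_periodic, ih]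
  induction r with
  | zero => simp
  | succ r ih =>
    rw [add_mul, one_mul, Finset.sum_range_add, ih]
    simp only [htet, harc]
    push_cast
    rw [add_mul, one_mul]
    rfl

variable [Finite I]

open Classical in
-- At most one translate of `s` in the infinite cover belongs to `ε`, so at most one term of the sum
-- survives, even when several integers have the same residue mod `n`.
theorem sum_edgeInd_mul {R : Type*} [CommRing R] (ε : c.infiniteCover.Edge) (j : I) (s : TetEdge)
    (g : ZMod n → R) :
    ∑ h, ((c.cyclicCover n).edgeInd (c.toCover (Int.castAddHom (ZMod n)) ε) (j, h) s : R) * g h =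
      if hm : ∃ m : ℤ, c.infiniteCover.edgeMk ((j, m), s) = ε then g (hm.choose : ZMod n)
      else 0 := by
  simp only [edgeInd_toCover]
  split_ifs with hm
  · rw [Finset.sum_eq_single (hm.choose : ZMod n)]
    · rw [if_pos ⟨_, hm.choose_spec, rfl⟩]
      simp
    · intro h _ hne
      rw [if_neg]
      · simp
      · rintro ⟨m, h1, rfl⟩
        rw [← hm.choose_spec] at h1
        exact hne (by rw [edgeMk_infiniteCover_injective j s h1])
    · simp
  · refine Finset.sum_eq_zero fun h _ => ?_
    rw [if_neg]
    · simp
    · rintro ⟨m, h1, _⟩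
      exact hm ⟨m, h1⟩

theorem sum_incidence_mul {R : Type*} [CommRing R] {I : Type*} (T : IdealTriangulation I)
    {κ : Type*} [Fintype κ] (E : T.Edge) (x : κ → I) (q : Fin 3) (g : κ → R) :
    ∑ h, (T.incidence E (x h) q : R) * g h =
      ∑ s : TetEdge, if shapeType s.1 = q then ∑ h, (T.edgeInd E (x h) s : R) * g h else 0 := by
  have h1 : ∀ h, (T.incidence E (x h) q : R) * g h =
      ∑ s : TetEdge, if shapeType s.1 = q then (T.edgeInd E (x h) s : R) * g h else 0 := by
    intro h
    have := congrArg (Int.cast : ℤ → R) (T.incidence_eq_sum E (x h) q)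
    push_cast at this
    rw [this, Finset.sum_mul]
    simp only [ite_mul, zero_mul]
  simp only [h1]
  rw [Finset.sum_comm]
  refine Finset.sum_congr rfl fun s _ => ?_
  split_ifs <;> simp

theorem sum_incidence_toCover (ε : c.infiniteCover.Edge) (j : I) (q : Fin 3) :
    ∑ h, ((c.cyclicCover n).incidence (c.toCover (Int.castAddHom (ZMod n)) ε) (j, h) q : ℤ) =
      T.incidence (c.coverProj (AddMonoidHom.id ℤ) ε) j q := by
  classical
  have := sum_incidence_mul (R := ℤ) (c.cyclicCover n) (c.toCover (Int.castAddHom (ZMod n)) ε)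
    (fun h : ZMod n => (j, h)) q (fun _ => 1)
  simp only [mul_one] at this
  rw [this, incidence_eq_sum]
  refine Finset.sum_congr rfl fun s _ => ?_
  have h2 := sum_edgeInd_mul (R := ℤ) c n ε j s (fun _ => 1)
  simp only [mul_one] at h2
  rw [h2]
  unfold edgeInd
  exact if_congr Iff.rfl (if_congr (c.edgeMk_eq_coverProj_iff ε j s).symm rfl rfl) rfl

open Classical in
theorem twistedGluingMatrix_apply [DecidableEq I] (lift : I → c.infiniteCover.Edge) (q : Fin 3)
    (i j : I) :
    twistedGluingMatrix c lift q i j = ∑ s : TetEdge, if shapeType s.1 = q then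
      (if hm : ∃ m : ℤ, c.infiniteCover.edgeMk ((j, m), s) = lift i then
        (LaurentPolynomial.T hm.choose : ℤ[T;T⁻¹]) else 0) else 0 := by
  have hz : ∀ (s : TetEdge) (hm : ∃ m : ℤ, c.infiniteCover.edgeMk ((j, m), s) = lift i) (k : ℤ),
      k ≠ hm.choose → c.infiniteCover.edgeInd (lift i) (j, k) s = 0 := by
    intro s hm k hk
    unfold edgeInd
    rw [if_neg]
    intro h
    exact hk (edgeMk_infiniteCover_injective j s (h.trans hm.choose_spec.symm))
  have hz' : ∀ (s : TetEdge), (¬ ∃ m : ℤ, c.infiniteCover.edgeMk ((j, m), s) = lift i) → ∀ k : ℤ,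
      c.infiniteCover.edgeInd (lift i) (j, k) s = 0 := by
    intro s hm k
    unfold edgeInd
    rw [if_neg]
    exact fun h => hm ⟨k, h⟩
  have h1 : ∀ k : ℤ, LaurentPolynomial.C (c.infiniteCover.incidence (lift i) (j, k) q : ℤ) *
      LaurentPolynomial.T k = ∑ s : TetEdge, if shapeType s.1 = q then
        LaurentPolynomial.C (c.infiniteCover.edgeInd (lift i) (j, k) s) * LaurentPolynomial.T k
        else 0 := by
    intro k
    rw [incidence_eq_sum, map_sum, Finset.sum_mul]
    refine Finset.sum_congr rfl fun s _ => ?_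
    split_ifs <;> simp
  simp only [twistedGluingMatrix, Matrix.of_apply, h1]
  rw [finsum_sum_comm]
  · refine Finset.sum_congr rfl fun s _ => ?_
    split_ifs with hq hm
    · rw [finsum_eq_single _ hm.choose]
      · have : c.infiniteCover.edgeInd (lift i) (j, hm.choose) s = 1 := by
          unfold edgeInd
          rw [if_pos hm.choose_spec]
        simp [this]
      · intro k hk
        simp [hz s hm k hk]
    · simp [hz' s hm]
    · simp
  · intro s _
    by_cases hm : ∃ m : ℤ, c.infiniteCover.edgeMk ((j, m), s) = lift i
    · refine (Set.finite_singleton hm.choose).subset fun k hk => ?_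
      by_contra hne
      exact hk (by simp [hz s hm k hne])
    · simp [hz' s hm, Function.HasFiniteSupport]

theorem rootOmega_pow_zpow (k : ZMod n) (m : ℤ) :
    (((rootOmega n ^ k.val) ^ m : ℂˣ) : ℂ) = ZMod.stdAddChar (k * (m : ZMod n)) := by
  have : k * (m : ZMod n) = (((k.val : ℤ) * m : ℤ) : ZMod n) := by
    push_cast
    rw [ZMod.natCast_val, ZMod.cast_id]
  rw [this, ZMod.stdAddChar_coe]
  simp only [rootOmega, Units.val_zpow_eq_zpow_val, Units.val_pow_eq_pow_val, Units.val_mk0]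
  rw [← zpow_natCast, ← zpow_mul, ← Complex.exp_int_mul]
  congr 1
  push_cast
  ring

/-- The position of a translate is both the exponent of `t` and, mod `n`, the deck coordinate in the
cyclic cover. Evaluation at `ω^k` is thus a finite Fourier transform of the rows of the cover. -/
theorem eval_twistedGluingMatrix [DecidableEq I] (lift : I → c.infiniteCover.Edge) (q : Fin 3)
    (k : ZMod n) (i j : I) :
    LaurentPolynomial.eval₂ (Int.castRingHom ℂ) (rootOmega n ^ k.val)
        (twistedGluingMatrix c lift q i j) =
      ∑ h, ((c.cyclicCover n).incidence (c.toCover (Int.castAddHom (ZMod n)) (lift i)) (j, h) q : ℂ)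
        * ZMod.stdAddChar (k * h) := by
  rw [sum_incidence_mul (R := ℂ) (c.cyclicCover n) (c.toCover (Int.castAddHom (ZMod n)) (lift i))
    (fun h : ZMod n => (j, h)) q (fun h => ZMod.stdAddChar (k * h)), twistedGluingMatrix_apply,
    map_sum]
  refine Finset.sum_congr rfl fun s _ => ?_
  rw [sum_edgeInd_mul (R := ℂ) c n (lift i) j s fun h => ZMod.stdAddChar (k * h)]
  split_ifs
  · rw [LaurentPolynomial.eval₂_T, rootOmega_pow_zpow]
  · simp
  · simp

end Cyclic

end DualCocycle

end IdealTriangulation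

namespace IdealTriangulation

variable {I : Type*} [Fintype I] (T : IdealTriangulation I)

/-! ### Equations encoded by Neumann-Zagier data -/

/-- The equation `B w = A v + t ν` for the row of an edge. -/
def EdgeEq (E : T.Edge) (w v : I → ℂ) (t : ℂ) : Prop :=
  ∑ j, ((T.incidence E j 2 : ℂ) - T.incidence E j 1) * w j =
    ∑ j, ((T.incidence E j 0 : ℂ) - T.incidence E j 1) * v j +
      t * (2 - ∑ j, (T.incidence E j 1 : ℂ))

theorem sum_symplectic (u v : Fin 3 → I → ℤ) :
    ∑ j, (u 0 j - u 1 j) * (v 2 j - v 1 j) - ∑ j, (u 2 j - u 1 j) * (v 0 j - v 1 j) =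
      ∑ j, ∑ r, (∑ q, symplecticCoeff q r * u q j) * v r j := by
  rw [← Finset.sum_sub_distrib]
  refine Finset.sum_congr rfl fun j _ => ?_
  simp [Fin.sum_univ_three, symplecticCoeff]
  ring

/-- A tetrahedron has two edges of each type, so all columns of `G`, `G'`, `G''` sum to `2` and the
coefficients cancel. The constants cancel because there are as many edges as tetrahedra. -/
theorem sum_edgeEq (e : I ≃ T.Edge) (w v : I → ℂ) (t : ℂ) :
    ∑ i, (∑ j, ((T.incidence (e i) j 2 : ℂ) - T.incidence (e i) j 1) * w j -
      (∑ j, ((T.incidence (e i) j 0 : ℂ) - T.incidence (e i) j 1) * v j +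
        t * (2 - ∑ j, (T.incidence (e i) j 1 : ℂ)))) = 0 := by
  let : Fintype T.Edge := Fintype.ofEquiv I e
  have h : ∀ j q, ∑ i, (T.incidence (e i) j q : ℂ) = 2 := by
    intro j q
    rw [Equiv.sum_comp e fun E => (T.incidence E j q : ℂ)]
    exact_mod_cast congrArg (Int.cast : ℤ → ℂ) (T.sum_incidence j q)
  rw [Finset.sum_sub_distrib, Finset.sum_add_distrib, ← Finset.mul_sum, Finset.sum_sub_distrib,
    Finset.sum_comm, Finset.sum_comm (f := fun i j => _ * v j), Finset.sum_comm (f := fun i j =>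
      (T.incidence (e i) j 1 : ℂ))]
  simp only [← Finset.sum_mul, Finset.sum_sub_distrib, h]
  simp

variable [DecidableEq I]

/-- The equation `B w = A v + t ν` for the row of a peripheral curve. -/
def CurveEq (γ : T.PeripheralCurve) (w v : I → ℂ) (t : ℂ) : Prop :=
  ∑ j, ((T.curveRow γ 2 j : ℂ) - T.curveRow γ 1 j) * w j =
    ∑ j, ((T.curveRow γ 0 j : ℂ) - T.curveRow γ 1 j) * v j +
      t * (0 - ∑ j, (T.curveRow γ 1 j : ℂ))

/-- The edge equation replaced by the curve follows from the others by `sum_edgeEq`. The right-hand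
side mentions neither the numbering nor `i₀`, so the deck group can act on its edge equations. -/
theorem nzDatum_mulVec_eq_iff (e : I ≃ T.Edge) (i₀ : I) (γ : T.PeripheralCurve) (z : I → ℂ)
    (w v : I → ℂ) (t : ℂ) :
    (T.nzDatum e i₀ γ z).Bc.mulVec w =
        (T.nzDatum e i₀ γ z).Ac.mulVec v + t • (fun i => ((T.nzDatum e i₀ γ z).ν i : ℂ)) ↔
      (∀ E, T.EdgeEq E w v t) ∧ T.CurveEq γ w v t := by
  have hcurve : (T.nzDatum e i₀ γ z).Bc.mulVec w i₀ =
        ((T.nzDatum e i₀ γ z).Ac.mulVec v + t • (fun i => ((T.nzDatum e i₀ γ z).ν i : ℂ))) i₀ ↔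
      T.CurveEq γ w v t := by
    simp [nzDatum, NZDatum.Bc, NZDatum.Ac, gluingMatrixCurve, CurveEq, Matrix.mulVec, dotProduct]
  have hedge : ∀ i, i ≠ i₀ → ((T.nzDatum e i₀ γ z).Bc.mulVec w i =
        ((T.nzDatum e i₀ γ z).Ac.mulVec v + t • (fun i => ((T.nzDatum e i₀ γ z).ν i : ℂ))) i ↔
      T.EdgeEq (e i) w v t) := by
    intro i hi
    simp [nzDatum, NZDatum.Bc, NZDatum.Ac, gluingMatrixCurve, gluingMatrix, EdgeEq, Matrix.mulVec,
      dotProduct, hi]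
  constructor
  · intro h
    refine ⟨fun E => ?_, hcurve.1 (congrFun h i₀)⟩
    obtain ⟨i, rfl⟩ := e.surjective E
    by_cases hi : i = i₀
    · subst hi
      have hs := T.sum_edgeEq e w v t
      rw [Finset.sum_eq_single i] at hs
      · exact sub_eq_zero.1 hs
      · intro k _ hk
        exact sub_eq_zero.2 ((hedge k hk).1 (congrFun h k))
      · simp
    · exact (hedge i hi).1 (congrFun h i)
  · rintro ⟨h1, h2⟩
    ext i
    by_cases hi : i = i₀
    · subst hi
      exact hcurve.2 h2
    · exact (hedge i hi).2 (h1 _)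

/-- The Neumann-Zagier relations. -/
theorem nzDatum_A_mul_B_transpose (e : I ≃ T.Edge) (i₀ : I) (γ : T.PeripheralCurve) (z : I → ℂ) :
    (T.nzDatum e i₀ γ z).A * (T.nzDatum e i₀ γ z).B.transpose =
      (T.nzDatum e i₀ γ z).B * (T.nzDatum e i₀ γ z).A.transpose := by
  have hEE : ∀ E E' : T.Edge,
      ∑ j, ((T.incidence E j 0 : ℤ) - T.incidence E j 1) *
        ((T.incidence E' j 2 : ℤ) - T.incidence E' j 1) =
      ∑ j, ((T.incidence E j 2 : ℤ) - T.incidence E j 1) *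
        ((T.incidence E' j 0 : ℤ) - T.incidence E' j 1) := fun E E' =>
    sub_eq_zero.1 ((sum_symplectic (fun q j => (T.incidence E j q : ℤ))
      (fun q j => (T.incidence E' j q : ℤ))).trans (T.sum_edgePairing_incidence E E'))
  have hEC : ∀ E : T.Edge,
      ∑ j, ((T.incidence E j 0 : ℤ) - T.incidence E j 1) *
        (T.curveRow γ 2 j - T.curveRow γ 1 j) =
      ∑ j, ((T.incidence E j 2 : ℤ) - T.incidence E j 1) *
        (T.curveRow γ 0 j - T.curveRow γ 1 j) := fun E =>
    sub_eq_zero.1 ((sum_symplectic (fun q j => (T.incidence E j q : ℤ))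
      (fun q j => T.curveRow γ q j)).trans (T.sum_edgePairing_curveRow E γ))
  ext x y
  by_cases hx : x = i₀ <;> by_cases hy : y = i₀
  · simp only [nzDatum, gluingMatrixCurve, gluingMatrix, Matrix.mul_apply, Matrix.transpose_apply,
      Matrix.sub_apply, hx, hy, Matrix.updateRow_self]
    exact Finset.sum_congr rfl fun j _ => mul_comm _ _
  · simp only [nzDatum, gluingMatrixCurve, gluingMatrix, Matrix.mul_apply, Matrix.transpose_apply,
      Matrix.sub_apply, hx, Matrix.updateRow_self, Matrix.updateRow_ne hy, Matrix.of_apply]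
    rw [Finset.sum_congr rfl fun j _ => mul_comm _ _, ← hEC,
      Finset.sum_congr rfl fun j _ => mul_comm _ _]
  · simp only [nzDatum, gluingMatrixCurve, gluingMatrix, Matrix.mul_apply, Matrix.transpose_apply,
      Matrix.sub_apply, hy, Matrix.updateRow_self, Matrix.updateRow_ne hx, Matrix.of_apply]
    exact hEC (e x)
  · simp only [nzDatum, gluingMatrixCurve, gluingMatrix, Matrix.mul_apply, Matrix.transpose_apply,
      Matrix.sub_apply, Matrix.updateRow_ne hx, Matrix.updateRow_ne hy, Matrix.of_apply]
    exact hEE (e x) (e y)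

theorem nzDatum_inv_mul_isSymm (e : I ≃ T.Edge) (i₀ : I) (γ : T.PeripheralCurve) (z : I → ℂ)
    (hB : IsUnit (T.nzDatum e i₀ γ z).Bc.det) :
    ((T.nzDatum e i₀ γ z).Bc⁻¹ * (T.nzDatum e i₀ γ z).Ac).IsSymm := by
  set D := T.nzDatum e i₀ γ z
  have h : D.Ac * D.Bc.transpose = D.Bc * D.Ac.transpose := by
    have := congrArg (fun M : Matrix I I ℤ => M.map (Int.castRingHom ℂ))
      (T.nzDatum_A_mul_B_transpose e i₀ γ z)
    simp only [Matrix.map_mul, Matrix.transpose_map] at this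
    exact this
  have hBt : IsUnit D.Bc.transpose.det := by rwa [Matrix.det_transpose]
  unfold Matrix.IsSymm
  rw [Matrix.transpose_mul, Matrix.transpose_nonsing_inv]
  calc D.Ac.transpose * D.Bc.transpose⁻¹
      = D.Bc⁻¹ * (D.Bc * D.Ac.transpose) * D.Bc.transpose⁻¹ := by
        rw [← mul_assoc, Matrix.nonsing_inv_mul _ hB, one_mul]
    _ = D.Bc⁻¹ * D.Ac := by
        rw [← h, mul_assoc, mul_assoc, Matrix.mul_nonsing_inv _ hBt, mul_one]

/-- The rows of the square matrix `G'' - G'` sum to zero, so it is singular. -/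
theorem exists_edgeEq_zero [Nonempty I] (e : I ≃ T.Edge) :
    ∃ w : I → ℂ, w ≠ 0 ∧ ∀ E, T.EdgeEq E w 0 0 := by
  let M : Matrix I I ℂ := Matrix.of fun i j =>
    (T.incidence (e i) j 2 : ℂ) - T.incidence (e i) j 1
  have hM : Matrix.vecMul (fun _ => (1 : ℂ)) M = 0 := by
    ext j
    have := T.sum_edgeEq e (Pi.single j 1) 0 0
    simpa [Matrix.vecMul, dotProduct, M, Pi.single_apply] using this
  obtain ⟨w, hw, h⟩ := Matrix.exists_mulVec_eq_zero_iff.2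
    (Matrix.exists_vecMul_eq_zero_iff.1 ⟨_, fun h => one_ne_zero (congrFun h (Classical.arbitrary I)),
      hM⟩)
  refine ⟨w, hw, fun E => ?_⟩
  obtain ⟨i, rfl⟩ := e.surjective E
  have := congrFun h i
  simpa [EdgeEq, Matrix.mulVec, dotProduct, M] using this

end IdealTriangulation

/-! ### Symmetric matrices that are almost invariant under a permutation -/

/-- By symmetry `g` is proportional to `w`, so the defect `S x y - S (σ x) (σ y)` is `κ w x w y`
with a constant `κ`. As `w` is invariant, each iteration of `σ` subtracts the same amount, and after
`n` iterations the total `n κ w x w y` must vanish. -/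
theorem Matrix.IsSymm.apply_perm_of_sub_eq_mul {J : Type*} {S : Matrix J J ℂ} (hS : S.IsSymm)
    (σ : J → J) {n : ℕ} (hn : n ≠ 0) (hσ : σ^[n] = id) {w : J → ℂ} (hw : w ≠ 0)
    (hwσ : ∀ x, w (σ x) = w x)
    (h : ∀ y, ∃ g, ∀ x, S x y - S (σ x) (σ y) = g * w x) (x y : J) :
    S (σ x) (σ y) = S x y := by
  choose g hg using h
  obtain ⟨y₀, hy₀⟩ := Function.ne_iff.1 hw
  have hgw : ∀ x, g x = g y₀ / w y₀ * w x := by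
    intro x
    have h1 := hg y₀ x
    have h2 := hg x y₀
    rw [hS.apply x y₀, hS.apply (σ x) (σ y₀), h1] at h2
    rw [div_mul_eq_mul_div, eq_div_iff hy₀, h2]
  have hit : ∀ m x y, S (σ^[m] x) (σ^[m] y) = S x y - m * (g y₀ / w y₀ * w y * w x) := by
    intro m
    induction m with
    | zero => simp
    | succ m ih =>
      intro x y
      rw [Function.iterate_succ_apply, Function.iterate_succ_apply, ih, hwσ, hwσ]
      have := hg y x
      rw [hgw] at this
      push_cast
      linear_combination -this
  have h0 := hit n x y
  rw [hσ] at h0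
  have h1 : g y₀ / w y₀ * w y * w x = 0 := by
    have : (n : ℂ) ≠ 0 := by exact_mod_cast hn
    have h2 : (n : ℂ) * (g y₀ / w y₀ * w y * w x) = 0 := by
      simp only [id] at h0
      linear_combination h0
    exact (mul_eq_zero.1 h2).resolve_left this
  have := hit 1 x y
  rw [h1] at this
  simpa using this

namespace IdealTriangulation

/-! ### Linear combinations of the row equations -/

section Linear

variable {I : Type*} [Fintype I] {T : IdealTriangulation I} {w w' v v' : I → ℂ} {t t' : ℂ}

theorem EdgeEq.sub {E : T.Edge} (h : T.EdgeEq E w v t) (h' : T.EdgeEq E w' v' t') :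
    T.EdgeEq E (w - w') (v - v') (t - t') := by
  unfold EdgeEq at *
  simp only [Pi.sub_apply, mul_sub, Finset.sum_sub_distrib (f := fun j => _ * w j),
    Finset.sum_sub_distrib (f := fun j => _ * v j), h, h']
  ring

theorem EdgeEq.smul {E : T.Edge} (a : ℂ) (h : T.EdgeEq E w v t) :
    T.EdgeEq E (a • w) (a • v) (a * t) := by
  unfold EdgeEq at *
  simp only [Pi.smul_apply, smul_eq_mul, mul_left_comm _ a, ← Finset.mul_sum, h]
  ring

theorem curveEq_sub_smul [DecidableEq I] (γ : T.PeripheralCurve) (w w₀ : I → ℂ)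
    (h : ¬ T.CurveEq γ w₀ 0 0) : ∃ g : ℂ, T.CurveEq γ (w - g • w₀) 0 0 := by
  simp only [CurveEq, Pi.zero_apply, mul_zero, Finset.sum_const_zero, zero_mul, add_zero] at *
  refine ⟨(∑ j, ((T.curveRow γ 2 j : ℂ) - T.curveRow γ 1 j) * w j) /
    ∑ j, ((T.curveRow γ 2 j : ℂ) - T.curveRow γ 1 j) * w₀ j, ?_⟩
  simp only [Pi.sub_apply, Pi.smul_apply, smul_eq_mul, mul_sub, mul_left_comm _ (_ / _)]
  rw [Finset.sum_sub_distrib, ← Finset.mul_sum, div_mul_cancel₀ _ h, sub_self]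

end Linear

/-! ### Deck-equivariance -/

variable {I : Type*} {n : ℕ}

/-- The translation of the tetrahedra of a cyclic cover. -/
def shift (l : ZMod n) : Equiv.Perm (I × ZMod n) :=
  (Equiv.refl I).prodCongr (Equiv.addRight l)

theorem shift_apply (l : ZMod n) (x : I × ZMod n) : shift l x = (x.1, x.2 + l) := rfl

theorem iterate_shift (l : ZMod n) (m : ℕ) (x : I × ZMod n) :
    (shift l)^[m] x = (x.1, x.2 + m * l) := by
  induction m with
  | zero => simp
  | succ m ih =>
    rw [Function.iterate_succ_apply', ih, shift_apply]
    push_cast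
    rw [add_mul, one_mul, add_assoc]

variable [NeZero n]

/-- The vector on the tetrahedra of the cyclic cover which restricts to `v` and transforms under
translations by the character of index `k`. -/
noncomputable def charVec (k : ZMod n) (v : I → ℂ) : I × ZMod n → ℂ :=
  fun x => ZMod.stdAddChar (k * x.2) * v x.1

theorem charVec_zero_apply (v : I → ℂ) (x : I × ZMod n) : charVec 0 v x = v x.1 := by
  simp [charVec]

theorem charVec_comp_shift (k l : ZMod n) (v : I → ℂ) :
    charVec k v ∘ shift l = (ZMod.stdAddChar (k * l) : ℂ) • charVec k v := by
  ext x
  simp [charVec, shift_apply, mul_add, AddChar.map_add_eq_mul]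
  ring

theorem charVec_eq_zero {k : ZMod n} {v : I → ℂ} (h : charVec k v = 0) : v = 0 := by
  ext j
  have := congrFun h (j, 0)
  simpa [charVec] using this

theorem charVec_zero (k : ZMod n) : charVec k (0 : I → ℂ) = 0 := by
  ext x
  simp [charVec]

theorem stdAddChar_ne_one {k : ZMod n} (hk : k ≠ 0) : (ZMod.stdAddChar k : ℂ) ≠ 1 := by
  intro h
  exact hk (ZMod.injective_stdAddChar (h.trans (AddChar.map_zero_eq_one _).symm))

/-- Orthogonality of characters; it expands a basis vector of the cover into vectors on which the
deck group acts by characters. -/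
theorem sum_charVec_single [DecidableEq I] (j : I) (h : ZMod n) :
    ∑ k : ZMod n, (ZMod.stdAddChar (-(k * h)) : ℂ) • charVec k (Pi.single j 1) =
      (n : ℂ) • (Pi.single (j, h) 1 : I × ZMod n → ℂ) := by
  ext x
  have h1 : ∀ k : ZMod n, (ZMod.stdAddChar (-(k * h)) : ℂ) * ZMod.stdAddChar (k * x.2) =
      ZMod.stdAddChar (k * (x.2 - h)) := by
    intro k
    rw [← AddChar.map_add_eq_mul]
    congr 1
    ring
  simp only [Finset.sum_apply, Pi.smul_apply, smul_eq_mul, charVec, ← mul_assoc, h1,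
    ← Finset.sum_mul, AddChar.sum_mulShift _ (ZMod.isPrimitive_stdAddChar n), ZMod.card, sub_eq_zero]
  obtain ⟨x1, x2⟩ := x
  by_cases h1 : x1 = j <;> by_cases h2 : x2 = h <;> simp [h1, h2]

/-- As a multiple of an invariant vector `U` is fixed by translation, yet translation multiplies it
by `ω^k ≠ 1`. Hence the ambiguity along `w₀` does not touch nontrivial characters. -/
theorem eq_zero_of_comp_shift {k : ZMod n} (hk : k ≠ 0) {w₀ : I → ℂ} {U : I × ZMod n → ℂ} {g : ℂ}
    (hU : U = g • charVec 0 w₀) (h : U ∘ shift 1 = (ZMod.stdAddChar k : ℂ) • U) : U = 0 := by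
  have h1 : U ∘ shift 1 = U := by
    rw [hU]
    have := charVec_comp_shift (0 : ZMod n) 1 w₀
    rw [zero_mul, AddChar.map_zero_eq_one, one_smul] at this
    nth_rw 2 [← this]
    rfl
  rw [h1] at h
  have h2 : ((ZMod.stdAddChar k : ℂ) - 1) • U = 0 := by rw [sub_smul, one_smul, ← h, sub_self]
  exact (smul_eq_zero.1 h2).resolve_left (sub_ne_zero.2 (stdAddChar_ne_one hk))

namespace DualCocycle

variable [Fintype I] {T : IdealTriangulation I} (c : T.DualCocycle)

theorem edgeEq_deck_iff (l : ZMod n) (E : (c.cyclicCover n).Edge) (w v : I × ZMod n → ℂ) (t : ℂ) :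
    (c.cyclicCover n).EdgeEq (c.deck _ l E) w v t ↔
      (c.cyclicCover n).EdgeEq E (w ∘ shift l) (v ∘ shift l) t := by
  have hinc : ∀ x q, (c.cyclicCover n).incidence (c.deck _ l E) (shift l x) q =
      (c.cyclicCover n).incidence E x q := fun x q => c.incidence_deck _ l E x.1 x.2 q
  unfold EdgeEq
  rw [← Equiv.sum_comp (shift l), ← Equiv.sum_comp (shift l) (fun x => _ * v x),
    ← Equiv.sum_comp (shift l) fun x => (((c.cyclicCover n).incidence _ x 1 : ℕ) : ℂ)]
  simp only [hinc, Function.comp_apply]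

theorem edgeEq_toCover_iff (ε : c.infiniteCover.Edge) (w v : I → ℂ) (t : ℂ) :
    (c.cyclicCover n).EdgeEq (c.toCover _ ε) (charVec 0 w) (charVec 0 v) t ↔
      T.EdgeEq (c.coverProj (AddMonoidHom.id ℤ) ε) w v t := by
  have h : ∀ j q, ∑ h, ((c.cyclicCover n).incidence (c.toCover (Int.castAddHom (ZMod n)) ε)
      (j, h) q : ℂ) = T.incidence (c.coverProj (AddMonoidHom.id ℤ) ε) j q := by
    intro j q
    have := congrArg (Int.cast : ℤ → ℂ) (c.sum_incidence_toCover n ε j q)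
    push_cast at this
    exact this
  unfold EdgeEq
  simp only [charVec_zero_apply, Fintype.sum_prod_type, ← Finset.sum_mul, Finset.sum_sub_distrib, h]

theorem edgeEq_charVec_iff [DecidableEq I] (lift : I → c.infiniteCover.Edge) (k : ZMod n) (i : I)
    (w v : I → ℂ) :
    (c.cyclicCover n).EdgeEq (c.toCover _ (lift i)) (charVec k w) (charVec k v) 0 ↔
      (laurentEval (twistedB c lift) (rootOmega n ^ k.val)).mulVec w i =
        (laurentEval (twistedA c lift) (rootOmega n ^ k.val)).mulVec v i := by
  unfold EdgeEq
  simp only [charVec, Fintype.sum_prod_type, ← mul_assoc, ← Finset.sum_mul, sub_mul,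
    Finset.sum_sub_distrib, ← eval_twistedGluingMatrix]
  simp [laurentEval, twistedA, twistedB, Matrix.mulVec, dotProduct, sub_mul]

/-- On deck-invariant vectors the lift of `γ ^ r` counts each arc of `γ` exactly `r` times, where
`r` is the order of `α(γ)` mod `n`; the factor `r ≠ 0` cancels. -/
theorem curveEq_liftCurve_iff [DecidableEq I] (γ : T.PeripheralCurve) (a : ZMod n) (w v : I → ℂ)
    (t : ℂ) :
    (c.cyclicCover n).CurveEq (c.liftCurve n γ a) (charVec 0 w) (charVec 0 v) t ↔
      T.CurveEq γ w v t := by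
  have h : ∀ j q, ∑ h, ((c.cyclicCover n).curveRow (c.liftCurve n γ a) q (j, h) : ℂ) =
      addOrderOf (c.eval γ : ZMod n) * T.curveRow γ q j := by
    intro j q
    have := congrArg (Int.cast : ℤ → ℂ) (c.sum_curveRow_liftCurve n γ a q j)
    push_cast at this
    exact this
  have hr : (addOrderOf (c.eval γ : ZMod n) : ℂ) ≠ 0 := by
    exact_mod_cast (addOrderOf_pos _).ne'
  unfold CurveEq
  simp only [charVec_zero_apply, Fintype.sum_prod_type, ← Finset.sum_mul, Finset.sum_sub_distrib, h]
  simp only [← mul_sub, mul_assoc, ← Finset.mul_sum]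
  rw [show ∀ A B r : ℂ, r * A + t * (0 - r * B) = r * (A + t * (0 - B)) by intros; ring]
  exact mul_right_inj' hr

/-- The Neumann-Zagier datum of a cyclic cover with respect to a lift of a curve. -/
noncomputable abbrev coverDatum [DecidableEq I] (en : I × ZMod n ≃ (c.cyclicCover n).Edge)
    (x₀ : I × ZMod n) (γ : T.PeripheralCurve) (a : ZMod n) (z : I → ℂ) : NZDatum (I × ZMod n) :=
  (c.cyclicCover n).nzDatum en x₀ (c.liftCurve n γ a) fun x => z x.1

/-- The blocks of the inverse propagator of a cyclic cover with respect to the action of the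
deck group. -/
noncomputable def blockForm [DecidableEq I] (D : NZDatum I) (lift : I → c.infiniteCover.Edge)
    (k : ZMod n) : Matrix I I ℂ :=
  if k = 0 then quadraticForm D.Ac D.Bc D.z
  else quadraticForm (laurentEval (twistedA c lift) (rootOmega n ^ k.val))
    (laurentEval (twistedB c lift) (rootOmega n ^ k.val)) D.z

/-! ### Decomposition of the matrices of the cover by characters -/

section Nondegenerate

variable {c} {e : I ≃ T.Edge} {i₀ : I} {lift : I → c.infiniteCover.Edge}
  (hlift : ∀ i, c.coverProj (AddMonoidHom.id ℤ) (lift i) = e i)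

include hlift in
theorem edgeEq_charVec_zero_iff (w v : I → ℂ) (t : ℂ) :
    (∀ E, (c.cyclicCover n).EdgeEq E (charVec 0 w) (charVec 0 v) t) ↔ ∀ E, T.EdgeEq E w v t := by
  constructor
  · intro h E
    obtain ⟨i, rfl⟩ := e.surjective E
    rw [← hlift, ← edgeEq_toCover_iff (n := n)]
    exact h _
  · intro h E
    obtain ⟨i, l, rfl⟩ := exists_deck_toCover (Int.castAddHom (ZMod n)) (lift := lift)
      (by simpa only [hlift] using e.surjective) E
    rw [edgeEq_deck_iff, charVec_comp_shift, charVec_comp_shift]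
    simp only [zero_mul, AddChar.map_zero_eq_one, one_smul]
    rw [edgeEq_toCover_iff]
    exact h _

variable [DecidableEq I] {γ : T.PeripheralCurve} {z : I → ℂ}
  {en : I × ZMod n ≃ (c.cyclicCover n).Edge} {x₀ : I × ZMod n} {a : ZMod n}

include hlift in
theorem edgeEq_charVec_iff_mulVec (k : ZMod n) (w v : I → ℂ) :
    (∀ E, (c.cyclicCover n).EdgeEq E (charVec k w) (charVec k v) 0) ↔
      (laurentEval (twistedB c lift) (rootOmega n ^ k.val)).mulVec w =
        (laurentEval (twistedA c lift) (rootOmega n ^ k.val)).mulVec v := by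
  constructor
  · intro h
    ext i
    exact (c.edgeEq_charVec_iff lift k i w v).1 (h _)
  · intro h E
    obtain ⟨i, l, rfl⟩ := exists_deck_toCover (Int.castAddHom (ZMod n)) (lift := lift)
      (by simpa only [hlift] using e.surjective) E
    rw [edgeEq_deck_iff, charVec_comp_shift, charVec_comp_shift]
    have := ((c.edgeEq_charVec_iff lift k i w v).2 (congrFun h i)).smul
      (ZMod.stdAddChar (k * l))
    rwa [mul_zero] at this

include hlift in
theorem coverDatum_mulVec_charVec_zero_iff (w v : I → ℂ) (t : ℂ) :
    (c.coverDatum en x₀ γ a z).Bc.mulVec (charVec 0 w) =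
        (c.coverDatum en x₀ γ a z).Ac.mulVec (charVec 0 v) +
          t • (fun x => ((c.coverDatum en x₀ γ a z).ν x : ℂ)) ↔
      (T.nzDatum e i₀ γ z).Bc.mulVec w =
        (T.nzDatum e i₀ γ z).Ac.mulVec v + t • (fun i => ((T.nzDatum e i₀ γ z).ν i : ℂ)) := by
  rw [nzDatum_mulVec_eq_iff, nzDatum_mulVec_eq_iff, edgeEq_charVec_zero_iff hlift,
    curveEq_liftCurve_iff]

theorem eq_zero_of_mulVec {J : Type*} [Fintype J] [DecidableEq J] {M : Matrix J J ℂ}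
    (hM : IsUnit M.det) {w : J → ℂ} (h : M.mulVec w = 0) : w = 0 := by
  rw [← Matrix.one_mulVec w, ← Matrix.nonsing_inv_mul M hM, ← Matrix.mulVec_mulVec, h,
    Matrix.mulVec_zero]

theorem isUnit_det_of_mulVec {J : Type*} [Fintype J] [DecidableEq J] {M : Matrix J J ℂ}
    (h : ∀ w, M.mulVec w = 0 → w = 0) : IsUnit M.det := by
  rw [isUnit_iff_ne_zero]
  intro h0
  obtain ⟨w, hw, h1⟩ := Matrix.exists_mulVec_eq_zero_iff.2 h0
  exact hw (h w h1)

include hlift in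
theorem isUnit_det_nzDatum_B (hB : IsUnit (c.coverDatum en x₀ γ a z).Bc.det) :
    IsUnit (T.nzDatum e i₀ γ z).Bc.det := by
  refine isUnit_det_of_mulVec fun w hw => ?_
  have := (coverDatum_mulVec_charVec_zero_iff (i₀ := i₀) (en := en) (x₀ := x₀) (a := a) (γ := γ)
    (z := z) hlift w 0 0).2 (by simpa using hw)
  rw [charVec_zero, Matrix.mulVec_zero, zero_smul, add_zero] at this
  exact charVec_eq_zero (eq_zero_of_mulVec hB this)

include hlift in
/-- The kernel of the edge rows of `B` is spanned by a deck-invariant vector. -/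
theorem exists_kernel_generator (hB : IsUnit (c.coverDatum en x₀ γ a z).Bc.det) :
    ∃ w₀ : I → ℂ, w₀ ≠ 0 ∧ ∀ W, (∀ E, (c.cyclicCover n).EdgeEq E W 0 0) →
      ∃ g : ℂ, W = g • charVec 0 w₀ := by
  have : Nonempty I := ⟨x₀.1⟩
  obtain ⟨w₀, hw₀, hE⟩ := T.exists_edgeEq_zero e
  have hE' : ∀ E, (c.cyclicCover n).EdgeEq E (charVec 0 w₀) 0 0 := by
    have := (edgeEq_charVec_zero_iff (n := n) hlift w₀ 0 0).2 hE
    rwa [charVec_zero] at this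
  have hker : ∀ W, (∀ E, (c.cyclicCover n).EdgeEq E W 0 0) →
      (c.cyclicCover n).CurveEq (c.liftCurve n γ a) W 0 0 → W = 0 := by
    intro W h1 h2
    refine eq_zero_of_mulVec hB ?_
    have := (nzDatum_mulVec_eq_iff _ en x₀ (c.liftCurve n γ a) (fun x => z x.1) W 0 0).2 ⟨h1, h2⟩
    simpa using this
  refine ⟨w₀, hw₀, fun W hW => ?_⟩
  -- Since `B` is invertible, the curve equation fails on the nonzero lift of `w₀`. A multiple of
  -- that lift can therefore be subtracted from `W` so that the curve equation holds.
  obtain ⟨g, hg⟩ := curveEq_sub_smul (c.liftCurve n γ a) W (charVec 0 w₀) fun h =>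
    hw₀ (charVec_eq_zero (hker _ hE' h))
  refine ⟨g, sub_eq_zero.1 (hker _ (fun E => ?_) hg)⟩
  have := (hW E).sub ((hE' E).smul g)
  simpa using this

theorem edgeEq_inv_mul (hB : IsUnit (c.coverDatum en x₀ γ a z).Bc.det) (V : I × ZMod n → ℂ)
    (E : (c.cyclicCover n).Edge) :
    (c.cyclicCover n).EdgeEq E
      (((c.coverDatum en x₀ γ a z).Bc⁻¹ * (c.coverDatum en x₀ γ a z).Ac).mulVec V) V 0 := by
  refine ((nzDatum_mulVec_eq_iff _ en x₀ (c.liftCurve n γ a) (fun x => z x.1) _ V 0).1 ?_).1 E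
  rw [Matrix.mulVec_mulVec, ← mul_assoc, Matrix.mul_nonsing_inv _ hB, one_mul, zero_smul, add_zero]

include hlift in
-- The curve row need not be invariant, but the edge equations are permuted by the deck group. The
-- column `y` and the translated column `shift l y` both solve them for the same right-hand side, so
-- they differ by a multiple of `w₀`; symmetry of `B⁻¹A` then forces the difference to vanish.
theorem inv_mul_shift (hB : IsUnit (c.coverDatum en x₀ γ a z).Bc.det) (l : ZMod n)
    (x y : I × ZMod n) :
    ((c.coverDatum en x₀ γ a z).Bc⁻¹ * (c.coverDatum en x₀ γ a z).Ac) (shift l x) (shift l y) =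
      ((c.coverDatum en x₀ γ a z).Bc⁻¹ * (c.coverDatum en x₀ γ a z).Ac) x y := by
  obtain ⟨w₀, hw₀, hker⟩ := exists_kernel_generator hlift hB
  refine (nzDatum_inv_mul_isSymm _ en x₀ _ _ hB).apply_perm_of_sub_eq_mul (shift l)
    (NeZero.ne n) (w := charVec 0 w₀) ?_ (fun h => hw₀ (charVec_eq_zero h)) ?_ ?_ x y
  · ext x
    · rw [iterate_shift]; rfl
    · rw [iterate_shift]; simp
  · intro x
    have := congrFun (charVec_comp_shift 0 l w₀) x
    simpa using this
  · intro y
    set S := (c.coverDatum en x₀ γ a z).Bc⁻¹ * (c.coverDatum en x₀ γ a z).Ac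
    have h1 : ∀ E, (c.cyclicCover n).EdgeEq E (S.mulVec (Pi.single y 1)) (Pi.single y 1) 0 :=
      edgeEq_inv_mul hB _
    have h2 : ∀ E, (c.cyclicCover n).EdgeEq E (S.mulVec (Pi.single (shift l y) 1) ∘ shift l)
        (Pi.single y 1) 0 := by
      intro E
      have := (edgeEq_deck_iff c l E _ _ 0).1
        (edgeEq_inv_mul hB (Pi.single (shift l y) 1) (c.deck _ l E))
      convert this using 1
      ext x
      simp [Pi.single_apply]
    obtain ⟨g, hg⟩ := hker _ fun E => by simpa using (h1 E).sub (h2 E)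
    refine ⟨g, fun x => ?_⟩
    simpa using congrFun hg x

include hlift in
theorem inv_mul_mulVec_comp_shift (hB : IsUnit (c.coverDatum en x₀ γ a z).Bc.det) (l : ZMod n)
    (V : I × ZMod n → ℂ) :
    ((c.coverDatum en x₀ γ a z).Bc⁻¹ * (c.coverDatum en x₀ γ a z).Ac).mulVec V ∘ shift l =
      ((c.coverDatum en x₀ γ a z).Bc⁻¹ * (c.coverDatum en x₀ γ a z).Ac).mulVec (V ∘ shift l) := by
  ext x
  simp only [Function.comp_apply, Matrix.mulVec, dotProduct]
  rw [← Equiv.sum_comp (shift l)]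
  simp only [inv_mul_shift hlift hB]

include hlift in
-- A kernel vector extends by the character `k` to a solution of the homogeneous edge equations of
-- the cover, hence to a multiple of the invariant `w₀`, which is zero as `k ≠ 0`.
theorem isUnit_det_twistedB (hB : IsUnit (c.coverDatum en x₀ γ a z).Bc.det) {k : ZMod n}
    (hk : k ≠ 0) : IsUnit (laurentEval (twistedB c lift) (rootOmega n ^ k.val)).det := by
  obtain ⟨w₀, -, hker⟩ := exists_kernel_generator hlift hB
  refine isUnit_det_of_mulVec fun v hv => ?_
  have h := (edgeEq_charVec_iff_mulVec hlift k v 0).2 (by rw [hv, Matrix.mulVec_zero])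
  rw [charVec_zero] at h
  obtain ⟨g, hg⟩ := hker _ h
  refine charVec_eq_zero (eq_zero_of_comp_shift hk hg ?_)
  rw [charVec_comp_shift, mul_one]

include hlift in
theorem inv_mul_mulVec_charVec_zero (hB : IsUnit (c.coverDatum en x₀ γ a z).Bc.det) (v : I → ℂ) :
    ((c.coverDatum en x₀ γ a z).Bc⁻¹ * (c.coverDatum en x₀ γ a z).Ac).mulVec (charVec 0 v) =
      charVec 0 (((T.nzDatum e i₀ γ z).Bc⁻¹ * (T.nzDatum e i₀ γ z).Ac).mulVec v) := by
  have := (coverDatum_mulVec_charVec_zero_iff (i₀ := i₀) (en := en) (x₀ := x₀) (a := a) (γ := γ)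
    (z := z) hlift (((T.nzDatum e i₀ γ z).Bc⁻¹ * (T.nzDatum e i₀ γ z).Ac).mulVec v) v 0).2 (by
      rw [Matrix.mulVec_mulVec, ← mul_assoc,
        Matrix.mul_nonsing_inv _ (isUnit_det_nzDatum_B hlift hB), one_mul, zero_smul, add_zero])
  rw [zero_smul, add_zero] at this
  rw [← Matrix.mulVec_mulVec, ← this, Matrix.mulVec_mulVec, Matrix.nonsing_inv_mul _ hB,
    Matrix.one_mulVec]

include hlift in
-- Both sides solve the edge equations for `charVec k v`, and both transform by the character `k`;
-- their difference lies on the line of `w₀` and so is zero. The curve row, which has no counterpart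
-- in `B(t)`, is bypassed.
theorem inv_mul_mulVec_charVec (hB : IsUnit (c.coverDatum en x₀ γ a z).Bc.det) {k : ZMod n}
    (hk : k ≠ 0) (v : I → ℂ) :
    ((c.coverDatum en x₀ γ a z).Bc⁻¹ * (c.coverDatum en x₀ γ a z).Ac).mulVec (charVec k v) =
      charVec k (((laurentEval (twistedB c lift) (rootOmega n ^ k.val))⁻¹ *
        laurentEval (twistedA c lift) (rootOmega n ^ k.val)).mulVec v) := by
  obtain ⟨w₀, -, hker⟩ := exists_kernel_generator hlift hB
  set S := (c.coverDatum en x₀ γ a z).Bc⁻¹ * (c.coverDatum en x₀ γ a z).Ac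
  set u := ((laurentEval (twistedB c lift) (rootOmega n ^ k.val))⁻¹ *
        laurentEval (twistedA c lift) (rootOmega n ^ k.val)).mulVec v with hu
  have h1 := (edgeEq_charVec_iff_mulVec hlift k u v).2 (by
    rw [hu, Matrix.mulVec_mulVec, ← mul_assoc,
      Matrix.mul_nonsing_inv _ (isUnit_det_twistedB hlift hB hk), one_mul])
  obtain ⟨g, hg⟩ := hker (S.mulVec (charVec k v) - charVec k u) fun E => by
    simpa using (edgeEq_inv_mul hB (charVec k v) E).sub (h1 E)
  refine sub_eq_zero.1 (eq_zero_of_comp_shift hk hg ?_)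
  change S.mulVec (charVec k v) ∘ shift 1 - charVec k u ∘ shift 1 = _
  rw [inv_mul_mulVec_comp_shift hlift hB, charVec_comp_shift, charVec_comp_shift, mul_one,
    Matrix.mulVec_smul, smul_sub]

include hlift in
theorem quadraticForm_mulVec_charVec (hB : IsUnit (c.coverDatum en x₀ γ a z).Bc.det) (k : ZMod n)
    (v : I → ℂ) :
    (quadraticForm (c.coverDatum en x₀ γ a z).Ac (c.coverDatum en x₀ γ a z).Bc
        (c.coverDatum en x₀ γ a z).z).mulVec (charVec k v) =
      charVec k ((c.blockForm (T.nzDatum e i₀ γ z) lift k).mulVec v) := by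
  have hdiag : (Matrix.diagonal fun x => 1 / (1 - (c.coverDatum en x₀ γ a z).z x)).mulVec
      (charVec k v) = charVec k ((Matrix.diagonal fun j => 1 / (1 - z j)).mulVec v) := by
    ext x
    simp [charVec, Matrix.mulVec_diagonal, nzDatum]
    ring
  have hlin : ∀ u u' : I → ℂ, charVec k (-u + u') = -charVec k u + charVec k u' := by
    intro u u'
    ext x
    simp [charVec]
    ring
  unfold quadraticForm blockForm
  rw [Matrix.add_mulVec, Matrix.neg_mulVec, hdiag]
  split_ifs with hk
  · subst hk
    rw [inv_mul_mulVec_charVec_zero (i₀ := i₀) hlift hB, quadraticForm, Matrix.add_mulVec,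
      Matrix.neg_mulVec, hlin]
    rfl
  · rw [inv_mul_mulVec_charVec hlift hB hk, quadraticForm, Matrix.add_mulVec, Matrix.neg_mulVec,
      hlin]
    rfl

include hlift in
theorem isUnit_det_blockForm (h : (c.coverDatum en x₀ γ a z).IsNondegenerate) (k : ZMod n) :
    IsUnit (c.blockForm (T.nzDatum e i₀ γ z) lift k).det := by
  refine isUnit_det_of_mulVec fun v hv => ?_
  have := quadraticForm_mulVec_charVec (i₀ := i₀) hlift h.1 k v
  rw [hv, charVec_zero] at this
  exact charVec_eq_zero (eq_zero_of_mulVec h.2 this)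

include hlift in
theorem inv_quadraticForm_mulVec_charVec (h : (c.coverDatum en x₀ γ a z).IsNondegenerate)
    (k : ZMod n) (v : I → ℂ) :
    (quadraticForm (c.coverDatum en x₀ γ a z).Ac (c.coverDatum en x₀ γ a z).Bc
        (c.coverDatum en x₀ γ a z).z)⁻¹.mulVec (charVec k v) =
      charVec k ((c.blockForm (T.nzDatum e i₀ γ z) lift k)⁻¹.mulVec v) := by
  have := quadraticForm_mulVec_charVec (i₀ := i₀) hlift h.1 k
    ((c.blockForm (T.nzDatum e i₀ γ z) lift k)⁻¹.mulVec v)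
  rw [Matrix.mulVec_mulVec, Matrix.mul_nonsing_inv _ (isUnit_det_blockForm hlift h k),
    Matrix.one_mulVec] at this
  rw [← this, Matrix.mulVec_mulVec, Matrix.nonsing_inv_mul _ h.2, Matrix.one_mulVec]

include hlift in
theorem inv_quadraticForm_apply (h : (c.coverDatum en x₀ γ a z).IsNondegenerate)
    (x y : I × ZMod n) :
    (quadraticForm (c.coverDatum en x₀ γ a z).Ac (c.coverDatum en x₀ γ a z).Bc
        (c.coverDatum en x₀ γ a z).z)⁻¹ x y =
      (n : ℂ)⁻¹ * ∑ k : ZMod n, ZMod.stdAddChar (k * (x.2 - y.2)) *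
        (c.blockForm (T.nzDatum e i₀ γ z) lift k)⁻¹ x.1 y.1 := by
  have hn : (n : ℂ) ≠ 0 := NeZero.ne _
  have h1 := congrArg (fun v => (quadraticForm (c.coverDatum en x₀ γ a z).Ac
    (c.coverDatum en x₀ γ a z).Bc (c.coverDatum en x₀ γ a z).z)⁻¹.mulVec v x)
    (sum_charVec_single y.1 y.2)
  simp only [Matrix.mulVec_sum, Matrix.mulVec_smul,
    inv_quadraticForm_mulVec_charVec (i₀ := i₀) hlift h] at h1
  rw [eq_inv_mul_iff_mul_eq₀ hn]
  simp only [Finset.sum_apply, Pi.smul_apply, smul_eq_mul, charVec, Matrix.mulVec_single_one,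
    Matrix.col_apply, ← mul_assoc, ← AddChar.map_add_eq_mul] at h1
  rw [← h1]
  refine Finset.sum_congr rfl fun k _ => ?_
  congr 2
  ring

include hlift in
-- This is the case `v = 0`, `t = 1` of the row equations: the pullback of the solution for `T`
-- solves the system of the cover, which has only one solution.
theorem inv_mulVec_nu (hB : IsUnit (c.coverDatum en x₀ γ a z).Bc.det) (x : I × ZMod n) :
    (c.coverDatum en x₀ γ a z).Bc⁻¹.mulVec (fun y => ((c.coverDatum en x₀ γ a z).ν y : ℂ)) x =
      (T.nzDatum e i₀ γ z).Bc⁻¹.mulVec (fun i => ((T.nzDatum e i₀ γ z).ν i : ℂ)) x.1 := by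
  set u := (T.nzDatum e i₀ γ z).Bc⁻¹.mulVec (fun i => ((T.nzDatum e i₀ γ z).ν i : ℂ)) with hu
  have := (coverDatum_mulVec_charVec_zero_iff (i₀ := i₀) (en := en) (x₀ := x₀) (a := a) (γ := γ)
    (z := z) hlift u 0 1).2 (by
      rw [hu, Matrix.mulVec_mulVec, Matrix.mul_nonsing_inv _ (isUnit_det_nzDatum_B hlift hB),
        Matrix.one_mulVec, Matrix.mulVec_zero, zero_add, one_smul])
  rw [charVec_zero, Matrix.mulVec_zero, zero_add, one_smul] at this
  rw [← this, Matrix.mulVec_mulVec, Matrix.nonsing_inv_mul _ hB, Matrix.one_mulVec,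
    charVec_zero_apply]

theorem inv_quadraticForm_isSymm (hB : IsUnit (c.coverDatum en x₀ γ a z).Bc.det) :
    (quadraticForm (c.coverDatum en x₀ γ a z).Ac (c.coverDatum en x₀ γ a z).Bc
        (c.coverDatum en x₀ γ a z).z)⁻¹.IsSymm := by
  unfold Matrix.IsSymm
  rw [Matrix.transpose_nonsing_inv, quadraticForm, Matrix.transpose_add, Matrix.transpose_neg,
    (nzDatum_inv_mul_isSymm _ en x₀ _ _ hB).eq, Matrix.diagonal_transpose]

end Nondegenerate

end DualCocycle

end IdealTriangulation

namespace FeynmanGraph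

/-! ### Connectedness, reorientation and finiteness -/

theorem IsConnected.of_iso {G G' : FeynmanGraph} (h : G.IsConnected) (f : Iso G G') :
    G'.IsConnected := by
  obtain ⟨⟨σ, τ, s⟩, hf⟩ := f
  have key : ∀ v w, Relation.EqvGen (fun a b => ∃ e, a = G.att e false ∧ b = G.att e true) v w →
      Relation.EqvGen (fun a b => ∃ e, a = G'.att e false ∧ b = G'.att e true) (σ v) (σ w) := by
    intro v w hvw
    induction hvw with
    | rel v w hr =>
      obtain ⟨e, rfl, rfl⟩ := hr
      have h0 := hf e false
      have h1 := hf e true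
      dsimp only at h0 h1
      rw [← h0, ← h1]
      cases s e
      · exact .rel _ _ ⟨τ e, rfl, rfl⟩
      · exact .symm _ _ (.rel _ _ ⟨τ e, rfl, rfl⟩)
    | refl v => exact .refl _
    | symm v w _ ih => exact .symm _ _ ih
    | trans u v w _ _ ih ih' => exact .trans _ _ _ ih ih'
  refine ⟨(σ ⟨0, h.1⟩).pos, fun v w => ?_⟩
  have := key _ _ (h.2 (σ.symm v) (σ.symm w))
  rwa [σ.apply_symm_apply, σ.apply_symm_apply] at this

/-- The identity as an isomorphism between a graph and a reorientation. -/
def reorientIso (G : FeynmanGraph) (s : Fin G.nE → Bool) : Iso G (G.reorient s) :=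
  ⟨(Equiv.refl _, Equiv.refl _, s), fun e b => by
    change G.att e (xor (xor b (s e)) (s e)) = G.att e b
    rw [Bool.xor_assoc, Bool.xor_self, Bool.xor_false]⟩

theorem degree_reorient (G : FeynmanGraph) (s : Fin G.nE → Bool) (v : Fin G.nV) :
    (G.reorient s).degree v = G.degree v := by
  unfold degree
  refine Finset.card_nbij' (fun h => (h.1, xor h.2 (s h.1))) (fun h => (h.1, xor h.2 (s h.1)))
    ?_ ?_ ?_ ?_
  · intro h hh
    simp only [Finset.coe_filter, Finset.mem_univ, true_and, Set.mem_ofPred_eq] at hh ⊢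
    exact hh
  · intro h hh
    simp only [Finset.coe_filter, Finset.mem_univ, true_and, Set.mem_ofPred_eq] at hh ⊢
    simpa [reorient] using hh
  · intro h _
    simp
  · intro h _
    simp

theorem symmetryFactor_reorient (G : FeynmanGraph) (s : Fin G.nE → Bool) :
    (G.reorient s).symmetryFactor = G.symmetryFactor := by
  -- An automorphism keeps its action on vertices and edges; its flip at `e` is corrected by the
  -- reversals `s` at the source `e` and at the target of `e`.
  refine Nat.card_congr (Equiv.subtypeEquiv
    ⟨fun p => (p.1, p.2.1, fun e => xor (xor (s e) (p.2.2 e)) (s (p.2.1 e))),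
     fun p => (p.1, p.2.1, fun e => xor (xor (s e) (p.2.2 e)) (s (p.2.1 e))), ?_, ?_⟩ ?_)
  · rintro ⟨σ, τ, p⟩
    simp only [Prod.mk.injEq, true_and]
    funext e
    cases s e <;> cases s (τ e) <;> simp
  · rintro ⟨σ, τ, p⟩
    simp only [Prod.mk.injEq, true_and]
    funext e
    cases s e <;> cases s (τ e) <;> simp
  · rintro ⟨σ, τ, p⟩
    refine forall_congr' fun e => ?_
    change (∀ b, G.att (τ e) (xor (xor b (p e)) (s (τ e))) = σ (G.att e (xor b (s e)))) ↔
      ∀ b, G.att (τ e) (xor b (xor (xor (s e) (p e)) (s (τ e)))) = σ (G.att e b)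
    cases s e <;> cases p e <;> cases s (τ e) <;> simp [and_comm]

/-- The underlying simple graph is connected, so it has at least `nV - 1` edges. The natural-number
subtraction in `betti` is therefore exact for connected graphs, as the exponent `d - 1` requires. -/
theorem IsConnected.nV_le {G : FeynmanGraph} (h : G.IsConnected) : G.nV ≤ G.nE + 1 := by
  classical
  let S : SimpleGraph (Fin G.nV) :=
    SimpleGraph.fromRel fun a b => ∃ e, a = G.att e false ∧ b = G.att e true
  have hreach : ∀ v w, Relation.EqvGen (fun a b => ∃ e, a = G.att e false ∧ b = G.att e true) v w →
      S.Reachable v w := by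
    intro v w hvw
    induction hvw with
    | rel v w hr =>
      by_cases hne : v = w
      · rw [hne]
      · exact SimpleGraph.Adj.reachable ((SimpleGraph.fromRel_adj _ _ _).2 ⟨hne, Or.inl hr⟩)
    | refl v => exact .refl _
    | symm v w _ ih => exact ih.symm
    | trans u v w _ _ ih ih' => exact ih.trans ih'
  have : Nonempty (Fin G.nV) := ⟨⟨0, h.1⟩⟩
  have hS : S.Connected := ⟨fun v w => hreach v w (h.2 v w)⟩
  have h1 := hS.card_vert_le_card_edgeSet_add_one
  have h2 : S.edgeSet ⊆ Set.range fun e => s(G.att e false, G.att e true) := by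
    intro x
    induction x with
    | _ v w =>
      intro hx
      rw [SimpleGraph.mem_edgeSet, SimpleGraph.fromRel_adj] at hx
      rcases hx.2 with ⟨e, rfl, rfl⟩ | ⟨e, rfl, rfl⟩
      · exact ⟨e, rfl⟩
      · exact ⟨e, Sym2.eq_swap⟩
  have h3 : Nat.card S.edgeSet ≤ G.nE := by
    have h4 := Nat.card_mono (Set.finite_range _) h2
    have h5 := Finite.card_range_le fun e : Fin G.nE => s(G.att e false, G.att e true)
    rw [Nat.card_fin] at h5
    exact h4.trans h5
  rw [Nat.card_fin] at h1
  omega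

theorem sum_degree (G : FeynmanGraph) : ∑ v, G.degree v = 2 * G.nE := by
  have := Finset.card_eq_sum_card_fiberwise (s := (Finset.univ : Finset (Fin G.nE × Bool)))
    (t := Finset.univ) (f := fun h => G.att h.1 h.2) (fun _ _ => Finset.mem_coe.2 (Finset.mem_univ _))
  simp only [Finset.card_univ, Fintype.card_prod, Fintype.card_fin, Fintype.card_bool] at this
  rw [mul_comm, this]
  rfl

/-- Counting half-edges, with vertices of degree 1 and 2 compensated, gives `3V ≤ 2E + 2n₁ + n₂`.
Together with `n₁ + n₂ + E + 1 - V ≤ ℓ` this bounds `V`, and then `E`. Truncation could only enlarge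
`betti`, so the second inequality is valid over the integers. -/
theorem IsDiagram.bounds {G : FeynmanGraph} {ℓ : ℕ} (h : G.IsDiagram ℓ) :
    G.nV ≤ 2 * ℓ ∧ G.nE ≤ 3 * ℓ := by
  obtain ⟨-, hdeg, hle⟩ := h
  have h1 : 3 * G.nV ≤ 2 * G.nE + 2 * G.numVertices 1 + G.numVertices 2 := by
    have : ∀ v ∈ (Finset.univ : Finset (Fin G.nV)), 3 ≤ G.degree v +
        2 * (if G.degree v = 1 then 1 else 0) + (if G.degree v = 2 then 1 else 0) := by
      intro v _
      have := hdeg v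
      split_ifs <;> omega
    have h2 := Finset.sum_le_sum this
    rw [Finset.sum_add_distrib, Finset.sum_add_distrib, sum_degree, ← Finset.mul_sum,
      ← Finset.card_filter, ← Finset.card_filter] at h2
    simpa [numVertices, mul_comm] using h2
  unfold betti at hle
  omega

theorem diagrams_finite (ℓ : ℕ) : (diagrams ℓ).Finite := by
  let F : (Σ (a : Fin (2 * ℓ + 1)) (b : Fin (3 * ℓ + 1)), Fin b → Bool → Fin a) →
      Quotient isoSetoid := fun x => Quotient.mk isoSetoid ⟨x.1, x.2.1, x.2.2⟩
  refine (Set.finite_range F).subset ?_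
  rintro g ⟨G, hG, rfl⟩
  obtain ⟨h1, h2⟩ := hG.bounds
  exact ⟨⟨⟨G.nV, by omega⟩, ⟨G.nE, by omega⟩, G.att⟩, rfl⟩

/-! ### Flows and characters -/

section Flow

variable {n : ℕ} (G : FeynmanGraph)

theorem sum_flow_mul_sub (φ : Fin G.nE → ZMod n) (h : Fin G.nV → ZMod n) :
    ∑ e, φ e * (h (G.att e false) - h (G.att e true)) =
      ∑ v, h v * (∑ e ∈ Finset.univ.filter (fun e => G.att e false = v), φ e -
        ∑ e ∈ Finset.univ.filter (fun e => G.att e true = v), φ e) := by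
  have key : ∀ b, ∑ v, h v * ∑ e ∈ Finset.univ.filter (fun e => G.att e b = v), φ e =
      ∑ e, φ e * h (G.att e b) := by
    intro b
    simp only [Finset.mul_sum, Finset.sum_filter]
    rw [Finset.sum_comm]
    refine Finset.sum_congr rfl fun e _ => ?_
    simp [mul_comm]
  simp only [mul_sub, Finset.sum_sub_distrib, key]

variable [NeZero n]

theorem _root_.AddChar.map_sum_eq_prod {A M ι : Type*} [AddCommMonoid A] [CommMonoid M]
    (ψ : AddChar A M) (s : Finset ι) (f : ι → A) : ψ (∑ i ∈ s, f i) = ∏ i ∈ s, ψ (f i) := by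
  classical
  induction s using Finset.induction_on with
  | empty => simp
  | insert i s hi ih => rw [Finset.sum_insert hi, Finset.prod_insert hi, ψ.map_add_eq_mul, ih]

open Classical in
-- Summation by parts moves the exponent from edges to vertices, where the coefficient of `h v` is
-- the net outflow at `v`. The sum over `h v` is then `n` or `0`, according to whether that outflow
-- vanishes.
theorem sum_prod_stdAddChar (φ : Fin G.nE → ZMod n) :
    ∑ h : Fin G.nV → ZMod n,
      ∏ e, (ZMod.stdAddChar (φ e * (h (G.att e false) - h (G.att e true))) : ℂ) =
      if G.IsFlow n φ then (n : ℂ) ^ G.nV else 0 := by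
  simp only [← AddChar.map_sum_eq_prod, sum_flow_mul_sub]
  simp only [AddChar.map_sum_eq_prod]
  rw [← Fintype.prod_sum (fun v (x : ZMod n) => (ZMod.stdAddChar (x *
    (∑ e ∈ Finset.univ.filter (fun e => G.att e false = v), φ e -
        ∑ e ∈ Finset.univ.filter (fun e => G.att e true = v), φ e)) : ℂ))]
  simp only [AddChar.sum_mulShift _ (ZMod.isPrimitive_stdAddChar n), ZMod.card, sub_eq_zero]
  split_ifs with hφ
  · rw [Finset.prod_congr rfl fun v _ => congrArg Nat.cast (if_pos (hφ v).symm)]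
    simp
  · obtain ⟨v, hv⟩ := not_forall.1 hφ
    refine Finset.prod_eq_zero (Finset.mem_univ v) ?_
    rw [if_neg fun h => hv h.symm]
    simp

open Classical in
-- Expanding the product chooses a frequency `φ e` on each edge. The propagators contribute
-- `n^{-E}`, the sum over `h` contributes `n^V` for each flow, and `V - E = 1 - d`.
theorem sum_prod_fourier (hG : G.IsConnected) (p : Fin G.nE → ZMod n → ℂ) :
    ∑ h : Fin G.nV → ZMod n, ∏ e, ((n : ℂ)⁻¹ *
      ∑ k, ZMod.stdAddChar (k * (h (G.att e false) - h (G.att e true))) * p e k) =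
    ((n : ℂ) ^ ((G.betti : ℤ) - 1))⁻¹ *
      ∑ φ ∈ Finset.univ.filter (fun φ : Fin G.nE → ZMod n => G.IsFlow n φ), ∏ e, p e (φ e) := by
  have hn : (n : ℂ) ≠ 0 := NeZero.ne _
  have hconst : ((n : ℂ) ^ ((G.betti : ℤ) - 1))⁻¹ = ((n : ℂ)⁻¹) ^ G.nE * (n : ℂ) ^ G.nV := by
    have := hG.nV_le
    rw [← zpow_neg, inv_pow, ← zpow_natCast, ← zpow_natCast, ← zpow_neg, ← zpow_add₀ hn]
    congr 1
    simp only [betti]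
    omega
  simp only [Finset.prod_mul_distrib, Finset.prod_const, Finset.card_univ, Fintype.card_fin,
    Fintype.prod_sum]
  rw [← Finset.mul_sum, Finset.sum_comm, hconst, mul_assoc]
  congr 1
  simp only [← Finset.sum_mul, sum_prod_stdAddChar, ite_mul, zero_mul]
  rw [← Finset.sum_filter, Finset.mul_sum]

end Flow

end FeynmanGraph

/-! ### Comparison of the weights -/

theorem HahnSeries.prod_single_one {ι : Type*} (s : Finset ι) (f : ι → ℂ) :
    ∏ i ∈ s, (HahnSeries.single (1 : ℤ) (f i) : LaurentSeries ℂ) =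
      HahnSeries.C (∏ i ∈ s, f i) * HahnSeries.single (1 : ℤ) (1 : ℂ) ^ s.card := by
  have h : ∀ i, (HahnSeries.single (1 : ℤ) (f i) : LaurentSeries ℂ) =
      HahnSeries.C (f i) * HahnSeries.single (1 : ℤ) (1 : ℂ) := by
    intro i
    rw [HahnSeries.C_apply, HahnSeries.single_mul_single, zero_add, mul_one]
  simp only [h, Finset.prod_mul_distrib, Finset.prod_const, map_prod]

namespace NZDatum

/-- Each propagator carries exactly one `ħ`, so `ħ^E` splits off and the comparison of propagators
is one of complex numbers. -/
theorem labelledWeight_eq_C_mul {J : Type*} [Fintype J] [DecidableEq J] (D : NZDatum J)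
    (G : FeynmanGraph) (ι : Fin G.nV → J) :
    D.labelledWeight G ι =
      HahnSeries.C (∏ e, (quadraticForm D.Ac D.Bc D.z)⁻¹ (ι (G.att e false)) (ι (G.att e true))) *
        ((∏ v, D.vertexFactor (G.degree v) (ι v)) *
          HahnSeries.single (1 : ℤ) (1 : ℂ) ^ G.nE) := by
  simp only [labelledWeight, propagator, propagatorOf, Matrix.map_apply,
    HahnSeries.prod_single_one, Finset.card_univ, Fintype.card_fin, mul_left_comm]

theorem weight_reorient {J : Type*} [Fintype J] [DecidableEq J] (D : NZDatum J)
    (hD : (quadraticForm D.Ac D.Bc D.z)⁻¹.IsSymm) (G : FeynmanGraph) (s : Fin G.nE → Bool) :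
    D.weight (G.reorient s) = D.weight G := by
  unfold weight
  rw [G.symmetryFactor_reorient]
  refine congrArg _ ?_
  change ∑ ι : Fin G.nV → J, D.labelledWeight (G.reorient s) ι = _
  refine Finset.sum_congr rfl fun ι _ => ?_
  refine (labelledWeight_eq_C_mul D (G.reorient s) ι).trans
    (Eq.trans ?_ (labelledWeight_eq_C_mul D G ι).symm)
  refine congrArg₂ (fun x y => HahnSeries.C x * (y * HahnSeries.single (1 : ℤ) (1 : ℂ) ^ G.nE))
    (Finset.prod_congr rfl fun e _ => ?_) (Finset.prod_congr rfl fun v _ => ?_)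
  · change (quadraticForm D.Ac D.Bc D.z)⁻¹ (ι (G.att e (xor false (s e))))
      (ι (G.att e (xor true (s e)))) = _
    cases s e
    · rfl
    · exact hD.apply _ _
  · exact congrArg (fun k => D.vertexFactor k (ι v)) (G.degree_reorient s v)

end NZDatum

namespace IdealTriangulation.DualCocycle

variable {I : Type*} [Fintype I] [DecidableEq I] {n : ℕ} [NeZero n] {T : IdealTriangulation I}
  {c : T.DualCocycle} {e : I ≃ T.Edge} {i₀ : I} {lift : I → c.infiniteCover.Edge}
  (hlift : ∀ i, c.coverProj (AddMonoidHom.id ℤ) (lift i) = e i) {γ : T.PeripheralCurve} {z : I → ℂ}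
  {en : I × ZMod n ≃ (c.cyclicCover n).Edge} {x₀ : I × ZMod n} {a : ZMod n}

omit [NeZero n] in
theorem flowPropagator_eq (D : NZDatum I) (k : ZMod n) (i j : I) :
    flowPropagator D (twistedA c lift) (twistedB c lift) n k i j =
      HahnSeries.single (1 : ℤ) ((c.blockForm D lift k)⁻¹ i j) := by
  unfold flowPropagator blockForm
  split_ifs <;> rfl

open Classical in
theorem labelledFlowWeight_eq_C_mul (D : NZDatum I) (G : FeynmanGraph) (ι : Fin G.nV → I) :
    labelledFlowWeight D (twistedA c lift) (twistedB c lift) n G ι =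
      HahnSeries.C (((n : ℂ) ^ ((G.betti : ℤ) - 1))⁻¹ *
        ∑ φ ∈ Finset.univ.filter (fun φ : Fin G.nE → ZMod n => G.IsFlow n φ),
          ∏ e, (c.blockForm D lift (φ e))⁻¹ (ι (G.att e false)) (ι (G.att e true))) *
        ((∏ v, D.vertexFactor (G.degree v) (ι v)) *
          HahnSeries.single (1 : ℤ) (1 : ℂ) ^ G.nE) := by
  simp only [labelledFlowWeight, flowPropagator_eq, HahnSeries.prod_single_one, Finset.card_univ,
    Fintype.card_fin, ← HahnSeries.C_mul_eq_smul, map_mul, map_sum, mul_assoc, Finset.sum_mul,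
    mul_left_comm (HahnSeries.C _) (∏ v, _)]

include hlift in
theorem vertexFactor_coverDatum (hB : IsUnit (c.coverDatum en x₀ γ a z).Bc.det) (k : ℕ)
    (x : I × ZMod n) :
    (c.coverDatum en x₀ γ a z).vertexFactor k x = (T.nzDatum e i₀ γ z).vertexFactor k x.1 := by
  unfold NZDatum.vertexFactor
  rw [inv_mulVec_nu (i₀ := i₀) hlift hB]
  rfl

include hlift in
-- A labelling by tetrahedra of the cover is a labelling `ι` by tetrahedra of `T` together with a
-- deck coordinate at each vertex. Vertex factors depend on `ι` only, and summing the propagators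
-- over the deck coordinates produces the flows.
theorem weight_coverDatum (h : (c.coverDatum en x₀ γ a z).IsNondegenerate) {G : FeynmanGraph}
    (hG : G.IsConnected) :
    (c.coverDatum en x₀ γ a z).weight G =
      flowWeight (T.nzDatum e i₀ γ z) (twistedA c lift) (twistedB c lift) n G := by
  classical
  unfold NZDatum.weight flowWeight
  congr 1
  rw [← Equiv.sum_comp (Equiv.arrowProdEquivProdArrow (Fin G.nV) (fun _ => I)
    (fun _ => ZMod n)).symm, Fintype.sum_prod_type]
  refine Finset.sum_congr rfl fun ι _ => ?_
  simp only [NZDatum.labelledWeight_eq_C_mul, labelledFlowWeight_eq_C_mul,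
    vertexFactor_coverDatum (i₀ := i₀) hlift h.1, inv_quadraticForm_apply (i₀ := i₀) hlift h]
  simp only [Equiv.arrowProdEquivProdArrow, Equiv.coe_fn_symm_mk, ← Finset.sum_mul, ← map_sum]
  rw [G.sum_prod_fourier hG fun x k => (c.blockForm (T.nzDatum e i₀ γ z) lift k)⁻¹
    (ι (G.att x false)) (ι (G.att x true))]

end IdealTriangulation.DualCocycle

open IdealTriangulation.DualCocycle in
theorem theorem3p3 {I : Type*} [Fintype I] [DecidableEq I]
    (T : IdealTriangulation I) (hT : T.IsOneCusped)
    (c : T.DualCocycle)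
    (e : I ≃ T.Edge) (i₀ : I)
    (lift : I → c.infiniteCover.Edge)
    (hlift : ∀ i, c.coverProj (AddMonoidHom.id ℤ) (lift i) = e i)
    (μ lam γ : T.PeripheralCurve) (hμ : c.eval μ = 1) (hlam : c.eval lam = 0)
    (hγ : γ = μ ∨ γ = lam)
    (z : I → ℂ) (hz : T.IsShapeSolution γ z)
    (n : ℕ) [NeZero n]
    (en : I × ZMod n ≃ (c.cyclicCover n).Edge) (x₀ : I × ZMod n) (a : ZMod n)
    (D : NZDatum I) (hD : D = T.nzDatum e i₀ γ z)
    (Dn : NZDatum (I × ZMod n))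
    (hDn : Dn = (c.cyclicCover n).nzDatum en x₀ (c.liftCurve n γ a) (fun x => z x.1))
    (hreg : Dn.IsNondegenerate)
    (At Bt : Matrix I I (LaurentPolynomial ℤ))
    (hAt : At = IdealTriangulation.twistedA c lift)
    (hBt : Bt = IdealTriangulation.twistedB c lift) :
    (D.IsNondegenerate ∧
      ∀ k : ZMod n, k ≠ 0 → IsNondegenerateAt D At Bt (rootOmega n ^ k.val)) ∧
    (∀ G : FeynmanGraph, G.IsConnected → ∀ s : Fin G.nE → Bool,
      flowWeight D At Bt n (G.reorient s) = flowWeight D At Bt n G) ∧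
    ∀ ℓ : ℕ, 2 ≤ ℓ →
      (FeynmanGraph.diagrams ℓ).Finite ∧
      ∀ f f'' : I × ZMod n → ℤ, Dn.IsFlattening f f'' → Dn.loopInvariant f ℓ =
        (∑ᶠ g ∈ FeynmanGraph.diagrams ℓ, flowWeight D At Bt n g.out).coeff ((ℓ : ℤ) - 1) +
          Dn.vacuum f ℓ := by
  subst hD hDn hAt hBt
  refine ⟨⟨⟨isUnit_det_nzDatum_B hlift hreg.1, ?_⟩, fun k hk =>
    ⟨isUnit_det_twistedB hlift hreg.1 hk, ?_⟩⟩, ?_, fun ℓ _ =>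
    ⟨FeynmanGraph.diagrams_finite ℓ, ?_⟩⟩
  · have := isUnit_det_blockForm (i₀ := i₀) hlift hreg 0
    rwa [blockForm, if_pos rfl] at this
  · have := isUnit_det_blockForm (i₀ := i₀) hlift hreg k
    rwa [blockForm, if_neg hk] at this
  · intro G hG s
    -- Reversing an edge transposes its propagator. In the flow weight this is not visibly harmless,
    -- but in the equal weight of the cover the propagator is symmetric.
    rw [← weight_coverDatum hlift hreg hG,
      ← weight_coverDatum hlift hreg (hG.of_iso (G.reorientIso s)),
      NZDatum.weight_reorient _ (inv_quadraticForm_isSymm hreg.1)]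
  · intro f f'' _
    unfold NZDatum.loopInvariant
    congr 2
    refine finsum_mem_congr rfl fun g hg => weight_coverDatum hlift hreg ?_
    obtain ⟨G, hG, rfl⟩ := hg
    -- The representative `g.out` is only isomorphic to the diagram `G`, so connectedness has to be
    -- transported.
    obtain ⟨i⟩ := Setoid.symm (Quotient.mk_out (s := FeynmanGraph.isoSetoid) G)
    exact hG.1.of_iso i
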